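/- Logarithms are binary and graphs are finite and simple. A graph $H$ is an *$r$-shallow minor* of a graph $G$ if $H$ can be obtained from $G$ by contracting pairwise disjoint subgraphs of $G$, each of radius at most $r$, and then taking a subgraph. Let $\omega_r(G)$ be the maximum $t\in\mathbb{N}$ such that $K_t$ is an $r$-shallow minor of $G$. A graph is *contained* in another if it is isomorphic to a subgraph of it, and $\boxtimes$ is the strong product. Let $\mathrm{tw}(G)$ be the tree-width of $G$, and let $\mathrm{sep}(G)$ be the minimum size of a set $S\subseteq V(G)$ such that each component of $G-S$ has at most $|V(G)|/2$ vertices. **Corollary.** Let $a,c>0$ be real numbers, let $n\geq 1$, and let $G$ be an $n$-vertex graph such that $\omega_r(G)\leq c(r+1)^a$ for every integer $r\geq 0$, and such that $n\geq(\log n)^{2a+1}$. If $n\geq 2$, then $G$ has a set $Y$ of at most $(n\log n)^{1-1/(2a+2)}$ vertices such that $G-Y$ is contained in $H\boxtimes K_m$ for some graph $H$ and some integer $m\geq 0$ with $$\mathrm{tw}(H)\leq c\,8^a\,n^{1/2-1/(2a+2)}\log n\quad\text{and}\quad m\leq c\,8^{a+1}(n\log n)^{1/2}.$$ Moreover (for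 every $n\geq 1$), $$\mathrm{tw}(G)\leq (c^2\,8^{2a+1}+1)(n\log n)^{1-1/(2a+2)}\quad\text{and}\quad \mathrm{sep}(G)\leq (c^2\,8^{2a+1}+1)(n\log n)^{1-1/(2a+2)}+1.$$ -/

import Mathlib

namespace ProductStructure

/-- The strong product `A ⊠ B`. -/
def strongProduct {α β : Type*} (A : SimpleGraph α) (B : SimpleGraph β) :
    SimpleGraph (α × β) where
  Adj p q := (p.1 = q.1 ∧ B.Adj p.2 q.2) ∨ (p.2 = q.2 ∧ A.Adj p.1 q.1) ∨
    (A.Adj p.1 q.1 ∧ B.Adj p.2 q.2)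
  symm := ⟨by
    rintro p q (⟨h, h'⟩ | ⟨h, h'⟩ | ⟨h, h'⟩)
    · exact Or.inl ⟨h.symm, h'.symm⟩
    · exact Or.inr (Or.inl ⟨h.symm, h'.symm⟩)
    · exact Or.inr (Or.inr ⟨h.symm, h'.symm⟩)⟩
  loopless := ⟨by
    rintro p (⟨_, h⟩ | ⟨_, h⟩ | ⟨h, _⟩)
    · exact B.irrefl h
    · exact A.irrefl h
    · exact A.irrefl h⟩

/-- A `T`-decomposition of `G` (a tree-decomposition indexed by the tree `T`). -/
structure TreeDecomposition {V ι : Type*} (G : SimpleGraph V) (T : SimpleGraph ι) where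
  isTree : T.IsTree
  bag : ι → Finset V
  edge_mem : ∀ v w : V, G.Adj v w → ∃ x : ι, v ∈ bag x ∧ w ∈ bag x
  connected : ∀ v : V, (T.induce {x : ι | v ∈ bag x}).Connected

/-- `G` has a tree-decomposition, indexed by a finite tree, all of whose bags have at most
`k` vertices, that is, one of width at most `k - 1`. -/
def HasBagSizeAtMost {V : Type*} (G : SimpleGraph V) (k : ℕ) : Prop :=
  ∃ (ι : Type) (_ : Finite ι) (T : SimpleGraph ι) (D : TreeDecomposition G T),
    ∀ x : ι, (D.bag x).card ≤ k

/-- The tree-width of a finite graph: the minimum, over all tree-decompositions, of the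
maximum bag size minus one. It is an integer, as the graph without vertices has tree-width
`-1`. -/
noncomputable def treewidth {V : Type*} (G : SimpleGraph V) : ℤ :=
  (sInf {k : ℕ | HasBagSizeAtMost G k} : ℕ) - 1

/-- `S` is a balanced separator of `G`: each component of `G - S` has at most half of the
vertices of `G`. -/
def IsBalancedSeparator {V : Type*} [Fintype V] (G : SimpleGraph V) (S : Finset V) : Prop :=
  ∀ C : (G.induce ((S : Set V)ᶜ)).ConnectedComponent,
    (C.supp.ncard : ℝ) ≤ (Fintype.card V : ℝ) / 2

/-- The separation-number: the minimum size of a balanced separator. -/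
noncomputable def separationNumber {V : Type*} [Fintype V] (G : SimpleGraph V) : ℕ :=
  sInf {k : ℕ | ∃ S : Finset V, IsBalancedSeparator G S ∧ S.card = k}

/-- `H` is an `r`-shallow minor of `G`: it is obtained from `G` by contracting pairwise
disjoint subgraphs `B i`, each of radius at most `r`, and then taking a subgraph. Here `B i`
is the subgraph that is contracted to the vertex `i` of `H` (a single vertex if nothing is
contracted). A subgraph without vertices has radius `⊤`, so each `B i` is nonempty and
connected. -/
def IsShallowMinor {W V : Type*} (r : ℕ) (H : SimpleGraph W) (G : SimpleGraph V) : Prop :=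
  ∃ B : W → G.Subgraph,
    (∀ i, (B i).coe.radius ≤ (r : ℕ∞)) ∧
    (∀ i j, i ≠ j → Disjoint (B i).verts (B j).verts) ∧
    (∀ i j, H.Adj i j → ∃ u ∈ (B i).verts, ∃ v ∈ (B j).verts, G.Adj u v)

/-- `ω_r(G)`: the maximum `t` such that `K_t` is an `r`-shallow minor of the finite graph
`G`. -/
noncomputable def shallowCliqueNumber {V : Type*} (r : ℕ) (G : SimpleGraph V) : ℕ :=
  sSup {t : ℕ | IsShallowMinor r (⊤ : SimpleGraph (Fin t)) G}

end ProductStructure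

/-! The proof is one recursion on a vertex set `D` with an attached clique model `S`: pairwise
adjacent disjoint sets of radius at most `2R` and bounded size. By the hypothesis on shallow
cliques, `S` never has more than `t` sets, where `t` is the clique bound at radius `2R`.

A set of `S` without neighbours in `D` is dropped. Otherwise `D` either has a sparse cut, a nonempty
`B` with at most half of the vertices of `D` and at most `ε|B|` neighbours in the rest of `D`, or is
an expander. In an expander, balls of radius `R` fill more than half of `D`, as `(1 + ε)^R ≥ |V|`.
Hence any two of them meet, and one vertex reaches the neighbourhoods of all sets of `S` by paths of
length at most `2R`; the union of these paths is a further set of the model (`exists_shallowSet`,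
`exists_cut_or_shallowSet`). At a sparse cut, the recursion continues on both sides.

The cut sets are not discarded. `exists_hasPartDecomposition_sdiff` proves two statements together:
a decomposition after removing at most `ε|D|` vertices, with cost `F(|D|/2)`, and one of all of `D`,
with cost `F(|D|)`, by adding the removed set to every bag. The smaller side of a cut uses the
second and the larger side the first, so removed sets are paid for only when the size halves, and
their costs sum geometrically. Counting vertices in bags gives the tree-width of `G`; counting parts
of size at most `m` gives a quotient `H` with `G` inside `H ⊠ K_m`. As nothing is deleted, `Y = ∅`
suffices.

The separator comes from the same recursion, following only the side with more than half of all
vertices (`exists_isBalancedSeparator`). The radius scale `Λ = (n log n)^(1/(2a+2))` balances the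
two costs, `t²R` for the clique model and `εn` for the cuts: both have order `Λ^(2a+1)`. -/

namespace ProductStructure
open Finset

/-! ### Joining two trees by an edge -/

section SumOfTrees

variable {ι κ : Type*} {T : SimpleGraph ι} {T' : SimpleGraph κ}

/-- The disjoint union of `T` and `T'` with an edge added between `x` and `y`. -/
def bridgeSum (T : SimpleGraph ι) (T' : SimpleGraph κ) (x : ι) (y : κ) : SimpleGraph (ι ⊕ κ) :=
  (T ⊕g T') ⊔ SimpleGraph.edge (Sum.inl x) (Sum.inr y)

lemma bridgeSum_adj_inl {x : ι} {y : κ} {i j : ι} (h : T.Adj i j) :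
    (bridgeSum T T' x y).Adj (Sum.inl i) (Sum.inl j) :=
  Or.inl (by simpa using h)

lemma bridgeSum_adj_inr {x : ι} {y : κ} {i j : κ} (h : T'.Adj i j) :
    (bridgeSum T T' x y).Adj (Sum.inr i) (Sum.inr j) :=
  Or.inl (by simpa using h)

lemma bridgeSum_adj_bridge (x : ι) (y : κ) :
    (bridgeSum T T' x y).Adj (Sum.inl x) (Sum.inr y) :=
  Or.inr (by simp [SimpleGraph.edge_adj])

/-- A connected graph is a tree when it has one edge fewer than vertices; the bridge supplies the
one edge that two separate trees lack. -/
lemma isTree_bridgeSum [Finite ι] [Finite κ] (hT : T.IsTree) (hT' : T'.IsTree) (x : ι) (y : κ) :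
    (bridgeSum T T' x y).IsTree := by
  rw [SimpleGraph.isTree_iff_connected_and_card] at hT hT' ⊢
  refine ⟨hT.1.sum_sup_edge hT'.1, ?_⟩
  have hne : (Sum.inl x : ι ⊕ κ) ≠ Sum.inr y := by simp
  have hnot : s(Sum.inl x, Sum.inr y) ∉ (T ⊕g T').edgeSet := by
    simp [SimpleGraph.mem_edgeSet]
  have hset : (bridgeSum T T' x y).edgeSet = insert s(Sum.inl x, Sum.inr y) (T ⊕g T').edgeSet := by
    rw [bridgeSum, SimpleGraph.edgeSet_sup, SimpleGraph.edgeSet_edge_of_ne hne, Set.union_comm]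
    rfl
  have hcard : Nat.card (T ⊕g T').edgeSet = Nat.card T.edgeSet + Nat.card T'.edgeSet := by
    rw [Nat.card_congr SimpleGraph.edgeSetSumEquiv, Nat.card_sum]
  rw [hset, Nat.card_coe_set_eq, Set.ncard_insert_of_notMem hnot, ← Nat.card_coe_set_eq, hcard,
    Nat.card_sum]
  omega

lemma connected_induce_inl {x : ι} {y : κ} {A : Set ι} (hA : (T.induce A).Connected) :
    ((bridgeSum T T' x y).induce (Sum.inl '' A)).Connected := by
  let f : T.induce A →g (bridgeSum T T' x y).induce (Sum.inl '' A) :=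
    { toFun := fun a => ⟨Sum.inl a.1, Set.mem_image_of_mem _ a.2⟩
      map_rel' := fun h => bridgeSum_adj_inl h }
  refine hA.map f ?_
  rintro ⟨_, a, ha, rfl⟩
  exact ⟨⟨a, ha⟩, rfl⟩

lemma connected_induce_inr {x : ι} {y : κ} {A : Set κ} (hA : (T'.induce A).Connected) :
    ((bridgeSum T T' x y).induce (Sum.inr '' A)).Connected := by
  let f : T'.induce A →g (bridgeSum T T' x y).induce (Sum.inr '' A) :=
    { toFun := fun a => ⟨Sum.inr a.1, Set.mem_image_of_mem _ a.2⟩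
      map_rel' := fun h => bridgeSum_adj_inr h }
  refine hA.map f ?_
  rintro ⟨_, a, ha, rfl⟩
  exact ⟨⟨a, ha⟩, rfl⟩

/-- Used for a part occurring in both decompositions: it lies in both root bags, so the bridge joins
its two subtrees. -/
lemma connected_induce_union {x : ι} {y : κ} {A : Set ι} {B : Set κ}
    (hA : (T.induce A).Connected) (hB : (T'.induce B).Connected) (hx : x ∈ A) (hy : y ∈ B) :
    ((bridgeSum T T' x y).induce (Sum.inl '' A ∪ Sum.inr '' B)).Connected := by
  exact SimpleGraph.connected_induce_union (connected_induce_inl hA).preconnected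
    (connected_induce_inr hB).preconnected (Set.mem_image_of_mem _ hx) (Set.mem_image_of_mem _ hy)
    (bridgeSum_adj_bridge x y)

end SumOfTrees

/-! ### Tree-decompositions by parts, and operations on them -/

section PartDecomposition

variable {V : Type*} {G : SimpleGraph V} {w : Finset V → ℝ} {m : ℕ}

/-- A partition of `D` into parts of size at most `m`, together with a tree-decomposition, indexed
by `T` and rooted at `root`, of the subgraph induced by `D` and the union of the parts in `S`, whose
bags are unions of parts. A bag is given by the set of its parts; its parts have total weight at
most `K`, and the root bag contains all parts in `S`. -/
structure PartDecomposition {ι : Type*} (G : SimpleGraph V) (w : Finset V → ℝ) (m : ℕ)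
    (D : Finset V) (S : Finset (Finset V)) (K : ℝ) (T : SimpleGraph ι) where
  isTree : T.IsTree
  root : ι
  bag : ι → Finset (Finset V)
  subset_root : S ⊆ bag root
  part : ∀ x, ∀ P ∈ bag x, P ∈ S ∨ (P ⊆ D ∧ P.Nonempty ∧ P.card ≤ m)
  disj : ∀ x y, ∀ P ∈ bag x, ∀ Q ∈ bag y, P ⊆ D → Q ⊆ D → P ≠ Q → Disjoint P Q
  cover : ∀ v ∈ D, ∃ x, ∃ P ∈ bag x, P ⊆ D ∧ v ∈ P
  edge_mem : ∀ u ∈ D, ∀ v, G.Adj u v → (v ∈ D ∨ ∃ P ∈ S, v ∈ P) →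
    ∃ x, (∃ P ∈ bag x, u ∈ P) ∧ ∃ Q ∈ bag x, v ∈ Q
  connected : ∀ x, ∀ P ∈ bag x, (T.induce {y | P ∈ bag y}).Connected
  weight_le : ∀ x, ∑ P ∈ bag x, w P ≤ K

/-- There is a part decomposition indexed by a finite tree. -/
def HasPartDecomposition (G : SimpleGraph V) (w : Finset V → ℝ) (m : ℕ)
    (D : Finset V) (S : Finset (Finset V)) (K : ℝ) : Prop :=
  ∃ (ι : Type) (_ : Finite ι) (T : SimpleGraph ι), Nonempty (PartDecomposition G w m D S K T)

lemma HasPartDecomposition.mono {D : Finset V} {S : Finset (Finset V)} {K K' : ℝ}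
    (h : HasPartDecomposition G w m D S K) (hK : K ≤ K') :
    HasPartDecomposition G w m D S K' := by
  obtain ⟨ι, hι, T, ⟨d⟩⟩ := h
  exact ⟨ι, hι, T, ⟨{ d with weight_le := fun x => (d.weight_le x).trans hK }⟩⟩

lemma hasPartDecomposition_empty {S : Finset (Finset V)} {K : ℝ} (hK : ∑ P ∈ S, w P ≤ K) :
    HasPartDecomposition G w m ∅ S K :=
  ⟨Unit, inferInstance, ⊥, ⟨{
    isTree := .of_subsingleton
    root := ()
    bag := fun _ => S
    subset_root := subset_rfl
    part := fun _ P hP => .inl hP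
    disj := fun _ _ P _ Q _ hP hQ hPQ => by
      simp only [subset_empty] at hP hQ
      exact absurd (hP.trans hQ.symm) hPQ
    cover := by simp
    edge_mem := by simp
    connected := fun x P hP => by
      have : Nonempty {y : Unit | P ∈ S} := ⟨⟨(), hP⟩⟩
      exact (SimpleGraph.IsTree.of_subsingleton).connected
    weight_le := fun _ => hK }⟩⟩

variable [DecidableEq V]

/-- A new part `X` may be split off. -/
lemma HasPartDecomposition.of_insert {D X : Finset V} {S : Finset (Finset V)} {K : ℝ}
    (h : HasPartDecomposition G w m (D \ X) (insert X S) K) (hXD : X ⊆ D) (hX : X.Nonempty)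
    (hXm : X.card ≤ m) (hS : ∀ P ∈ S, P.Nonempty ∧ Disjoint P D) :
    HasPartDecomposition G w m D S K := by
  obtain ⟨ι, hι, T, ⟨d⟩⟩ := h
  have hnot : ∀ P ∈ S, ¬ P ⊆ D := fun P hP hPD => by
    obtain ⟨a, ha⟩ := (hS P hP).1
    exact disjoint_left.1 (hS P hP).2 ha (hPD ha)
  have hXroot : X ∈ d.bag d.root := d.subset_root (mem_insert_self _ _)
  have hpart : ∀ x, ∀ P ∈ d.bag x, P ⊆ D → P = X ∨ P ⊆ D \ X := fun x P hP hPD => by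
    rcases d.part x P hP with h | h
    · rcases mem_insert.1 h with h | h
      · exact .inl h
      · exact absurd hPD (hnot P h)
    · exact .inr h.1
  refine ⟨ι, hι, T, ⟨{
    isTree := d.isTree
    root := d.root
    bag := d.bag
    subset_root := (subset_insert _ _).trans d.subset_root
    part := fun x P hP => ?_
    disj := fun x y P hP Q hQ hPD hQD hPQ => ?_
    cover := fun v hv => ?_
    edge_mem := fun u hu v huv hv => ?_
    connected := d.connected
    weight_le := d.weight_le }⟩⟩
  · rcases d.part x P hP with h | h
    · rcases mem_insert.1 h with rfl | h
      · exact .inr ⟨hXD, hX, hXm⟩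
      · exact .inl h
    · exact .inr ⟨h.1.trans sdiff_subset, h.2⟩
  · rcases hpart x P hP hPD with rfl | hP'
    · rcases hpart y Q hQ hQD with rfl | hQ'
      · exact absurd rfl hPQ
      · exact disjoint_sdiff.mono_right hQ'
    · rcases hpart y Q hQ hQD with rfl | hQ'
      · exact sdiff_disjoint.mono_left hP'
      · exact d.disj x y P hP Q hQ hP' hQ' hPQ
  · by_cases hvX : v ∈ X
    · exact ⟨d.root, X, hXroot, hXD, hvX⟩
    · obtain ⟨x, P, hP, hPD, hvP⟩ := d.cover v (mem_sdiff.2 ⟨hv, hvX⟩)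
      exact ⟨x, P, hP, hPD.trans sdiff_subset, hvP⟩
  · by_cases huX : u ∈ X
    · rcases hv with hv | ⟨P, hP, hvP⟩
      · by_cases hvX : v ∈ X
        · exact ⟨d.root, ⟨X, hXroot, huX⟩, X, hXroot, hvX⟩
        -- The edge is read from its other end: for the smaller decomposition, `u` belongs to the
        -- attached part `X`.
        · obtain ⟨x, h₁, h₂⟩ := d.edge_mem v (mem_sdiff.2 ⟨hv, hvX⟩) u huv.symm
            (.inr ⟨X, mem_insert_self _ _, huX⟩)
          exact ⟨x, h₂, h₁⟩
      · exact ⟨d.root, ⟨X, hXroot, huX⟩, P, d.subset_root (mem_insert_of_mem hP), hvP⟩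
    · refine d.edge_mem u (mem_sdiff.2 ⟨hu, huX⟩) v huv ?_
      rcases hv with hv | ⟨P, hP, hvP⟩
      · by_cases hvX : v ∈ X
        · exact .inr ⟨X, mem_insert_self _ _, hvX⟩
        · exact .inl (mem_sdiff.2 ⟨hv, hvX⟩)
      · exact .inr ⟨P, mem_insert_of_mem hP, hvP⟩

/-- A set `Z`, partitioned into small parts, may be added to all bags. -/
lemma HasPartDecomposition.add_parts {D Z : Finset V} {S Q : Finset (Finset V)} {K K' : ℝ}
    (h : HasPartDecomposition G w m (D \ Z) S K) (hw : ∀ P, 0 ≤ w P) (hZ : Z ⊆ D)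
    (hQne : ∀ P ∈ Q, P.Nonempty) (hQm : ∀ P ∈ Q, P.card ≤ m)
    (hQd : ∀ P ∈ Q, ∀ P' ∈ Q, P ≠ P' → Disjoint P P') (hQZ : ∀ v, v ∈ Z ↔ ∃ P ∈ Q, v ∈ P)
    (hQw : ∑ P ∈ Q, w P ≤ K') (hS : ∀ P ∈ S, P.Nonempty ∧ Disjoint P D) :
    HasPartDecomposition G w m D S (K + K') := by
  obtain ⟨ι, hι, T, ⟨d⟩⟩ := h
  have hnot : ∀ P ∈ S, ¬ P ⊆ D := fun P hP hPD => by
    obtain ⟨a, ha⟩ := (hS P hP).1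
    exact disjoint_left.1 (hS P hP).2 ha (hPD ha)
  have hQsub : ∀ P ∈ Q, P ⊆ Z := fun P hP a ha => (hQZ a).2 ⟨P, hP, ha⟩
  have hpart : ∀ x, ∀ P ∈ d.bag x ∪ Q, P ⊆ D → P ∈ Q ∨ (P ∈ d.bag x ∧ P ⊆ D \ Z) :=
    fun x P hP hPD => by
      rcases mem_union.1 hP with hP | hP
      · rcases d.part x P hP with h | h
        · exact absurd hPD (hnot P h)
        · exact .inr ⟨hP, h.1⟩
      · exact .inl hP
  refine ⟨ι, hι, T, ⟨{
    isTree := d.isTree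
    root := d.root
    bag := fun x => d.bag x ∪ Q
    subset_root := d.subset_root.trans subset_union_left
    part := fun x P hP => ?_
    disj := fun x y P hP P' hP' hPD hPD' hPP' => ?_
    cover := fun v hv => ?_
    edge_mem := fun u hu v huv hv => ?_
    connected := fun x P hP => ?_
    weight_le := fun x => ?_ }⟩⟩
  · rcases mem_union.1 hP with hP | hP
    · exact (d.part x P hP).imp_right fun h => ⟨h.1.trans sdiff_subset, h.2⟩
    · exact .inr ⟨(hQsub P hP).trans hZ, hQne P hP, hQm P hP⟩
  · rcases hpart x P hP hPD with h | h
    · rcases hpart y P' hP' hPD' with h' | h'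
      · exact hQd P h P' h' hPP'
      · exact disjoint_sdiff.mono (hQsub P h) h'.2
    · rcases hpart y P' hP' hPD' with h' | h'
      · exact sdiff_disjoint.mono h.2 (hQsub P' h')
      · exact d.disj x y P h.1 P' h'.1 h.2 h'.2 hPP'
  · by_cases hvZ : v ∈ Z
    · obtain ⟨P, hP, hvP⟩ := (hQZ v).1 hvZ
      exact ⟨d.root, P, mem_union_right _ hP, (hQsub P hP).trans hZ, hvP⟩
    · obtain ⟨x, P, hP, hPD, hvP⟩ := d.cover v (mem_sdiff.2 ⟨hv, hvZ⟩)
      exact ⟨x, P, mem_union_left _ hP, hPD.trans sdiff_subset, hvP⟩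
  -- Since `Q` is in every bag, an edge with one end in `Z` is covered by any bag that contains its
  -- other end.
  · have key : ∀ a, (a ∈ D ∨ ∃ P ∈ S, a ∈ P) → ∃ x, ∃ P ∈ d.bag x ∪ Q, a ∈ P := by
      rintro a (ha | ⟨P, hP, haP⟩)
      · by_cases haZ : a ∈ Z
        · obtain ⟨P, hP, haP⟩ := (hQZ a).1 haZ
          exact ⟨d.root, P, mem_union_right _ hP, haP⟩
        · obtain ⟨x, P, hP, -, haP⟩ := d.cover a (mem_sdiff.2 ⟨ha, haZ⟩)
          exact ⟨x, P, mem_union_left _ hP, haP⟩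
      · exact ⟨d.root, P, mem_union_left _ (d.subset_root hP), haP⟩
    by_cases huZ : u ∈ Z
    · obtain ⟨P, hP, huP⟩ := (hQZ u).1 huZ
      obtain ⟨x, hx⟩ := key v hv
      exact ⟨x, ⟨P, mem_union_right _ hP, huP⟩, hx⟩
    by_cases hvZ : v ∈ Z
    · obtain ⟨P, hP, hvP⟩ := (hQZ v).1 hvZ
      obtain ⟨x, hx⟩ := key u (.inl hu)
      exact ⟨x, hx, P, mem_union_right _ hP, hvP⟩
    obtain ⟨x, ⟨P, hP, huP⟩, P', hP', hvP'⟩ := d.edge_mem u (mem_sdiff.2 ⟨hu, huZ⟩) v huv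
      (hv.imp_left fun h => mem_sdiff.2 ⟨h, hvZ⟩)
    exact ⟨x, ⟨P, mem_union_left _ hP, huP⟩, P', mem_union_left _ hP', hvP'⟩
  · by_cases hPQ : P ∈ Q
    · have : {y | P ∈ d.bag y ∪ Q} = Set.univ := by ext y; simp [hPQ]
      rw [this]
      exact (SimpleGraph.induceUnivIso T).connected_iff.2 d.isTree.connected
    · have : {y | P ∈ d.bag y ∪ Q} = {y | P ∈ d.bag y} := by ext y; simp [hPQ]
      rw [this]
      exact d.connected x P ((mem_union.1 hP).resolve_right hPQ)
  · refine le_trans ?_ (add_le_add (d.weight_le x) hQw)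
    rw [← sum_union_inter]
    exact le_add_of_nonneg_right (sum_nonneg fun P _ => hw P)

/-- Two part decompositions may be glued along their roots. -/
lemma HasPartDecomposition.glue {D₁ D₂ : Finset V} {S S' : Finset (Finset V)} {K : ℝ}
    (h₁ : HasPartDecomposition G w m D₁ S K) (h₂ : HasPartDecomposition G w m D₂ S' K)
    (hSS' : S' ⊆ S) (hD : Disjoint D₁ D₂) (hadj : ∀ u ∈ D₁, ∀ v ∈ D₂, ¬ G.Adj u v)
    (hadj' : ∀ P ∈ S, P ∉ S' → ∀ u ∈ D₂, ∀ v ∈ P, ¬ G.Adj u v)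
    (hS : ∀ P ∈ S, P.Nonempty ∧ Disjoint P (D₁ ∪ D₂)) :
    HasPartDecomposition G w m (D₁ ∪ D₂) S K := by
  obtain ⟨ι, hι, T, ⟨d⟩⟩ := h₁
  obtain ⟨κ, hκ, T', ⟨e⟩⟩ := h₂
  have hnot : ∀ P ∈ S, ¬ P ⊆ D₁ ∪ D₂ := fun P hP hPD => by
    obtain ⟨a, ha⟩ := (hS P hP).1
    exact disjoint_left.1 (hS P hP).2 ha (hPD ha)
  have hd : ∀ x, ∀ P ∈ d.bag x, P ⊆ D₁ ∪ D₂ → P ⊆ D₁ := fun x P hP hPD =>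
    ((d.part x P hP).resolve_left fun h => hnot P h hPD).1
  have he : ∀ x, ∀ P ∈ e.bag x, P ⊆ D₁ ∪ D₂ → P ⊆ D₂ := fun x P hP hPD =>
    ((e.part x P hP).resolve_left fun h => hnot P (hSS' h) hPD).1
  -- A common part outside `S'` would be a nonempty subset of both `D₁` and `D₂`. So common parts
  -- lie in both root bags.
  have hboth : ∀ x y, ∀ P ∈ d.bag x, P ∈ e.bag y → P ∈ S' := fun x y P hP hP' => by
    by_contra hPS
    have h2 := (e.part y P hP').resolve_left hPS
    have h1 := hd x P hP (h2.1.trans subset_union_right)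
    obtain ⟨a, ha⟩ := h2.2.1
    exact disjoint_left.1 hD (h1 ha) (h2.1 ha)
  refine ⟨ι ⊕ κ, inferInstance, bridgeSum T T' d.root e.root, ⟨{
    isTree := isTree_bridgeSum d.isTree e.isTree _ _
    root := Sum.inl d.root
    bag := Sum.elim d.bag e.bag
    subset_root := d.subset_root
    part := ?_
    disj := ?_
    cover := fun v hv => ?_
    edge_mem := fun u hu v huv hv => ?_
    connected := ?_
    weight_le := ?_ }⟩⟩
  · rintro (x | x) P hP
    · exact (d.part x P hP).imp_right fun h => ⟨h.1.trans subset_union_left, h.2⟩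
    · exact (e.part x P hP).imp (fun h => hSS' h) fun h => ⟨h.1.trans subset_union_right, h.2⟩
  · rintro (x | x) (y | y) P hP Q hQ hPD hQD hPQ
    · exact d.disj x y P hP Q hQ (hd x P hP hPD) (hd y Q hQ hQD) hPQ
    · exact hD.mono (hd x P hP hPD) (he y Q hQ hQD)
    · exact hD.symm.mono (he x P hP hPD) (hd y Q hQ hQD)
    · exact e.disj x y P hP Q hQ (he x P hP hPD) (he y Q hQ hQD) hPQ
  · rcases mem_union.1 hv with hv | hv
    · obtain ⟨x, P, hP, hPD, hvP⟩ := d.cover v hv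
      exact ⟨Sum.inl x, P, hP, hPD.trans subset_union_left, hvP⟩
    · obtain ⟨x, P, hP, hPD, hvP⟩ := e.cover v hv
      exact ⟨Sum.inr x, P, hP, hPD.trans subset_union_right, hvP⟩
  · rcases mem_union.1 hu with hu | hu
    · obtain ⟨x, h⟩ := d.edge_mem u hu v huv <| hv.imp_left fun hv =>
        (mem_union.1 hv).resolve_right fun hv => hadj u hu v hv huv
      exact ⟨Sum.inl x, h⟩
    · obtain ⟨x, h⟩ := e.edge_mem u hu v huv <| hv.imp
        (fun hv => (mem_union.1 hv).resolve_left fun hv => hadj v hv u hu huv.symm)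
        fun ⟨P, hP, hvP⟩ => ⟨P, by_contra fun hPS => hadj' P hP hPS u hu v hvP huv, hvP⟩
      exact ⟨Sum.inr x, h⟩
  · have hset : ∀ P, {y | P ∈ Sum.elim d.bag e.bag y} =
        Sum.inl '' {y | P ∈ d.bag y} ∪ Sum.inr '' {y | P ∈ e.bag y} := fun P => by
      ext (y | y) <;> simp
    rintro z P hP
    rw [hset]
    by_cases hPd : ∃ x, P ∈ d.bag x
    · obtain ⟨x, hx⟩ := hPd
      by_cases hPe : ∃ y, P ∈ e.bag y
      · obtain ⟨y, hy⟩ := hPe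
        have hPS := hboth x y P hx hy
        exact connected_induce_union (d.connected x P hx) (e.connected y P hy)
          (d.subset_root (hSS' hPS)) (e.subset_root hPS)
      · have : {y | P ∈ e.bag y} = ∅ := by
          ext y; simpa using fun h => hPe ⟨y, h⟩
        rw [this, Set.image_empty, Set.union_empty]
        exact connected_induce_inl (d.connected x P hx)
    · have : {y | P ∈ d.bag y} = ∅ := by
        ext y; simpa using fun h => hPd ⟨y, h⟩
      rw [this, Set.image_empty, Set.empty_union]
      rcases z with z | z
      · exact absurd ⟨z, hP⟩ hPd
      · exact connected_induce_inr (e.connected z P hP)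
  · rintro (x | x)
    · exact d.weight_le x
    · exact e.weight_le x

end PartDecomposition

/-! ### From part decompositions to tree-width and strong products -/

section Treewidth

variable {V : Type*} {G : SimpleGraph V}

lemma treewidth_le {k : ℕ} (h : HasBagSizeAtMost G k) : treewidth G ≤ (k : ℤ) - 1 := by
  have : sInf {k : ℕ | HasBagSizeAtMost G k} ≤ k := Nat.sInf_le h
  unfold treewidth
  omega

variable [Fintype V]

/-- A part decomposition of the whole graph yields a tree-decomposition, whose bags are the unions
of the bags of the part decomposition. -/
lemma HasPartDecomposition.hasBagSizeAtMost {m : ℕ} {K : ℝ}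
    (h : HasPartDecomposition G (fun P => (P.card : ℝ)) m univ ∅ K) :
    HasBagSizeAtMost G ⌊K⌋₊ := by
  classical
  obtain ⟨ι, hι, T, ⟨d⟩⟩ := h
  refine ⟨ι, hι, T, ⟨d.isTree, fun x => (d.bag x).biUnion id, fun v w hvw => ?_, fun v => ?_⟩,
    fun x => ?_⟩
  · obtain ⟨x, ⟨P, hP, hvP⟩, Q, hQ, hwQ⟩ := d.edge_mem v (mem_univ _) w hvw (.inl (mem_univ _))
    exact ⟨x, mem_biUnion.2 ⟨P, hP, hvP⟩, mem_biUnion.2 ⟨Q, hQ, hwQ⟩⟩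
  · obtain ⟨x, P, hP, -, hvP⟩ := d.cover v (mem_univ _)
    -- Disjointness makes `P` the only part containing `v`, so the subtree of `v` is that of `P`.
    have : {y | v ∈ (d.bag y).biUnion id} = {y | P ∈ d.bag y} := by
      ext y
      simp only [Set.mem_ofPred_eq, mem_biUnion, id]
      constructor
      · rintro ⟨Q, hQ, hvQ⟩
        by_contra hy
        have hne : P ≠ Q := by rintro rfl; exact hy hQ
        exact disjoint_left.1 (d.disj x y P hP Q hQ (subset_univ _) (subset_univ _) hne) hvP hvQ
      · exact fun h => ⟨P, h, hvP⟩
    rw [this]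
    exact d.connected x P hP
  · refine card_biUnion_le.trans ?_
    refine Nat.le_floor ?_
    push_cast
    exact d.weight_le x

/-- A part decomposition of the whole graph, with bags of at most `K` parts of size at most `m`,
places the graph inside a product. -/
lemma HasPartDecomposition.exists_strongProduct {m : ℕ} {K : ℝ}
    (h : HasPartDecomposition G (fun _ => 1) m univ ∅ K) :
    ∃ (W : Type) (_ : Fintype W) (H : SimpleGraph W),
      G.IsContained (strongProduct H (⊤ : SimpleGraph (Fin m))) ∧ HasBagSizeAtMost H ⌊K⌋₊ := by
  classical
  obtain ⟨ι, hι, T, ⟨d⟩⟩ := h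
  have hdisj : ∀ {x y P Q v}, P ∈ d.bag x → Q ∈ d.bag y → v ∈ P → v ∈ Q → P = Q := by
    intro x y P Q v hP hQ hvP hvQ
    by_contra hne
    exact disjoint_left.1 (d.disj x y P hP Q hQ (subset_univ _) (subset_univ _) hne) hvP hvQ
  -- Numbering the parts puts the vertices of `H` in `Type`, whatever the universe of `V`.
  obtain ⟨N, ⟨e⟩⟩ := Finite.exists_equiv_fin {P : Finset V // ∃ x, P ∈ d.bag x}
  let part : Fin N → Finset V := fun a => (e.symm a).1
  have hpart : ∀ a, ∃ x, part a ∈ d.bag x := fun a => (e.symm a).2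
  have hinj : Function.Injective part := fun a b hab => e.symm.injective (Subtype.ext hab)
  have hsurj : ∀ x, ∀ P ∈ d.bag x, ∃ a, part a = P := fun x P hP =>
    ⟨e ⟨P, x, hP⟩, by simp [part]⟩
  have hcard : ∀ a, (part a).card ≤ m := fun a => by
    obtain ⟨x, hx⟩ := hpart a
    exact ((d.part x _ hx).resolve_left (notMem_empty _)).2.2
  have hcov : ∀ v, ∃ a, v ∈ part a := fun v => by
    obtain ⟨x, P, hP, -, hvP⟩ := d.cover v (mem_univ _)
    obtain ⟨a, rfl⟩ := hsurj x P hP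
    exact ⟨a, hvP⟩
  choose idx hidx using hcov
  let H : SimpleGraph (Fin N) := SimpleGraph.fromRel
    fun a b => ∃ u ∈ part a, ∃ v ∈ part b, G.Adj u v
  refine ⟨Fin N, inferInstance, H, ?_, ι, hι, T, ⟨d.isTree,
    fun x => univ.filter fun a => part a ∈ d.bag x, fun a b hab => ?_, fun a => ?_⟩, fun x => ?_⟩
  -- The embedding sends a vertex to its part and its position within that part; `H` is the quotient
  -- of `G` by the parts.
  · let pos : V → Fin m := fun v =>
      Fin.castLE (hcard (idx v)) ((part (idx v)).equivFin ⟨v, hidx v⟩)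
    have hpos : ∀ u v, idx u = idx v → pos u = pos v → u = v := by
      intro u v hi hp
      have hp' : ((part (idx u)).equivFin ⟨u, hidx u⟩).1 =
          ((part (idx v)).equivFin ⟨v, hidx v⟩).1 := congrArg Fin.val hp
      -- The two numberings have types depending on the part; with free indices, equality of the
      -- parts can be substituted.
      have key : ∀ (a b : Fin N) (ha : u ∈ part a) (hb : v ∈ part b), a = b →
          ((part a).equivFin ⟨u, ha⟩).1 = ((part b).equivFin ⟨v, hb⟩).1 → u = v := by
        rintro a b ha hb rfl h
        simpa using (part a).equivFin.injective (Fin.ext h)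
      exact key _ _ _ _ hi hp'
    refine ⟨⟨⟨fun v => (idx v, pos v), fun {u v} huv => ?_⟩, fun u v huv => ?_⟩⟩
    · by_cases hi : idx u = idx v
      · exact .inl ⟨hi, fun hp => huv.ne (hpos u v hi hp)⟩
      · have hadj : H.Adj (idx u) (idx v) :=
          (SimpleGraph.fromRel_adj _ _ _).2 ⟨hi, .inl ⟨u, hidx u, v, hidx v, huv⟩⟩
        by_cases hp : pos u = pos v
        · exact .inr (.inl ⟨hp, hadj⟩)
        · exact .inr (.inr ⟨hadj, hp⟩)
    · exact hpos u v (congrArg Prod.fst huv) (congrArg Prod.snd huv)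
  · obtain ⟨-, hab⟩ := (SimpleGraph.fromRel_adj _ _ _).1 hab
    have : ∃ u ∈ part a, ∃ v ∈ part b, G.Adj u v := by
      rcases hab with h | ⟨u, hu, v, hv, h⟩
      · exact h
      · exact ⟨v, hv, u, hu, h.symm⟩
    obtain ⟨u, hu, v, hv, huv⟩ := this
    obtain ⟨x, ⟨P, hP, huP⟩, Q, hQ, hvQ⟩ := d.edge_mem u (mem_univ _) v huv (.inl (mem_univ _))
    obtain ⟨y, hy⟩ := hpart a
    obtain ⟨z, hz⟩ := hpart b
    have h1 := hdisj hP hy huP hu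
    have h2 := hdisj hQ hz hvQ hv
    subst h1 h2
    exact ⟨x, by simpa using hP, by simpa using hQ⟩
  · obtain ⟨x, hx⟩ := hpart a
    have : {y | a ∈ univ.filter fun a => part a ∈ d.bag y} = {y | part a ∈ d.bag y} := by
      ext y; simp
    rw [this]
    exact d.connected x _ hx
  · have h1 : (univ.filter fun a => part a ∈ d.bag x).card ≤ (d.bag x).card :=
      card_le_card_of_injOn part (by simp [Set.MapsTo]) hinj.injOn
    have h2 := d.weight_le x
    simp only [sum_const, nsmul_eq_mul, mul_one] at h2
    exact h1.trans (Nat.le_floor h2)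

end Treewidth

/-! ### Shallow sets and clique models -/

section ShallowSets

variable {V : Type*} {G : SimpleGraph V}

/-- `P` induces a subgraph of radius at most `r`. -/
def IsShallowSet (G : SimpleGraph V) (r : ℕ) (P : Finset V) : Prop :=
  ∃ v ∈ P, ∀ u ∈ P, ∃ p : G.Walk v u, p.length ≤ r ∧ ∀ x ∈ p.support, x ∈ P

lemma IsShallowSet.nonempty {r : ℕ} {P : Finset V} (h : IsShallowSet G r P) : P.Nonempty :=
  ⟨h.choose, h.choose_spec.1⟩

lemma isShallowSet_singleton (r : ℕ) (v : V) : IsShallowSet G r {v} :=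
  ⟨v, mem_singleton_self v, fun u hu => by
    obtain rfl := mem_singleton.1 hu
    exact ⟨.nil, Nat.zero_le _, by simp⟩⟩

/-- The given centre has eccentricity at most `r`, because a walk with support in `P` survives in
the induced subgraph. -/
lemma IsShallowSet.radius_le {r : ℕ} {P : Finset V} (h : IsShallowSet G r P) :
    ((⊤ : G.Subgraph).induce (P : Set V)).coe.radius ≤ r := by
  obtain ⟨v, hv, hP⟩ := h
  refine (iInf_le _ (⟨v, hv⟩ : ((⊤ : G.Subgraph).induce (P : Set V)).verts)).trans ?_
  rw [SimpleGraph.eccent_le_iff]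
  rintro ⟨u, hu⟩
  obtain ⟨p, hp, hsup⟩ := hP u hu
  have key : ∀ {a b : V} (q : G.Walk a b) (ha : a ∈ P) (hb : b ∈ P), (∀ x ∈ q.support, x ∈ P) →
      ((⊤ : G.Subgraph).induce (P : Set V)).coe.edist ⟨a, ha⟩ ⟨b, hb⟩ ≤ q.length := by
    intro a b q
    induction q with
    | nil => intro ha hb _; simp
    | @cons a c b hac q ih =>
      intro ha hb hq
      have hc : c ∈ P := hq c (by simp)
      have hadj : ((⊤ : G.Subgraph).induce (P : Set V)).coe.Adj ⟨a, ha⟩ ⟨c, hc⟩ := by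
        simpa using ⟨ha, hc, hac⟩
      refine SimpleGraph.edist_triangle.trans ((add_le_add
        (SimpleGraph.edist_eq_one_iff_adj.2 hadj).le
        (ih hc hb fun x hx => hq x (by simp [hx]))).trans ?_)
      rw [SimpleGraph.Walk.length_cons, add_comm]
      push_cast
      rfl
  exact (key p hv hu hsup).trans (by exact_mod_cast hp)

/-- A model of a clique by pairwise adjacent disjoint shallow sets of size at most `s`. -/
structure IsCliqueModel (G : SimpleGraph V) (r s : ℕ) (S : Finset (Finset V)) : Prop where
  shallow : ∀ P ∈ S, IsShallowSet G r P
  card_le : ∀ P ∈ S, P.card ≤ s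
  disj : ∀ P ∈ S, ∀ Q ∈ S, P ≠ Q → Disjoint P Q
  adj : ∀ P ∈ S, ∀ Q ∈ S, P ≠ Q → ∃ u ∈ P, ∃ v ∈ Q, G.Adj u v

lemma IsCliqueModel.subset {r s : ℕ} {S S' : Finset (Finset V)} (h : IsCliqueModel G r s S)
    (hS : S' ⊆ S) : IsCliqueModel G r s S' :=
  ⟨fun P hP => h.shallow P (hS hP), fun P hP => h.card_le P (hS hP),
    fun P hP Q hQ => h.disj P (hS hP) Q (hS hQ), fun P hP Q hQ => h.adj P (hS hP) Q (hS hQ)⟩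

lemma IsCliqueModel.insert [DecidableEq V] {r s : ℕ} {S : Finset (Finset V)} {X : Finset V}
    (h : IsCliqueModel G r s S) (hX : IsShallowSet G r X) (hXs : X.card ≤ s)
    (hXd : ∀ P ∈ S, Disjoint P X) (hXa : ∀ P ∈ S, ∃ u ∈ P, ∃ v ∈ X, G.Adj u v) :
    IsCliqueModel G r s (insert X S) := by
  refine ⟨?_, ?_, ?_, ?_⟩
  · simpa [hX] using h.shallow
  · simpa [hXs] using h.card_le
  · intro P hP Q hQ hPQ
    rcases mem_insert.1 hP with hP' | hP' <;> rcases mem_insert.1 hQ with hQ' | hQ'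
    · exact absurd (hP'.trans hQ'.symm) hPQ
    · exact hP' ▸ (hXd Q hQ').symm
    · exact hQ' ▸ hXd P hP'
    · exact h.disj P hP' Q hQ' hPQ
  · intro P hP Q hQ hPQ
    rcases mem_insert.1 hP with hP' | hP' <;> rcases mem_insert.1 hQ with hQ' | hQ'
    · exact absurd (hP'.trans hQ'.symm) hPQ
    · obtain ⟨u, hu, v, hv, huv⟩ := hXa Q hQ'
      exact ⟨v, hP' ▸ hv, u, hu, huv.symm⟩
    · exact hQ' ▸ hXa P hP'
    · exact h.adj P hP' Q hQ' hPQ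

/-- Induced subgraphs on the sets of the model form a shallow clique minor. The supremum is genuine
because disjoint nonempty branch sets bound the clique order by the number of vertices. -/
lemma IsCliqueModel.card_le_shallowCliqueNumber [Finite V] {r s : ℕ} {S : Finset (Finset V)}
    (h : IsCliqueModel G r s S) : S.card ≤ shallowCliqueNumber r G := by
  have hbdd : BddAbove {t : ℕ | IsShallowMinor r (⊤ : SimpleGraph (Fin t)) G} := by
    refine ⟨Nat.card V, ?_⟩
    rintro t ⟨B, hr, hd, -⟩
    have hne : ∀ i, (B i).verts.Nonempty := fun i => by
      by_contra hi
      rw [Set.not_nonempty_iff_eq_empty] at hi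
      have : IsEmpty (B i).verts := by rw [hi]; infer_instance
      have := hr i
      simp [SimpleGraph.radius, iInf_of_empty] at this
    choose f hf using hne
    have hinj : Function.Injective f := fun i j hij => by
      by_contra hne
      exact Set.disjoint_left.1 (hd i j hne) (hf i) (hij ▸ hf j)
    simpa using Nat.card_le_card_of_injective f hinj
  refine le_csSup hbdd ⟨fun i => (⊤ : G.Subgraph).induce (S.equivFin.symm i).1,
    fun i => (h.shallow _ (S.equivFin.symm i).2).radius_le, fun i j hij => ?_, fun i j hij => ?_⟩
  · simpa using h.disj _ (S.equivFin.symm i).2 _ (S.equivFin.symm j).2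
      fun he => hij (S.equivFin.symm.injective (Subtype.ext he))
  · simpa using h.adj _ (S.equivFin.symm i).2 _ (S.equivFin.symm j).2
      fun he => hij (S.equivFin.symm.injective (Subtype.ext he))

end ShallowSets

/-! ### Growing balls in sets without sparse cuts -/

section BallGrowing

variable {V : Type*} [DecidableEq V] {G : SimpleGraph V}

open Classical in
/-- The neighbours of `B` inside `D`. -/
noncomputable def outerBoundary (G : SimpleGraph V) (D B : Finset V) : Finset V :=
  {v ∈ D | v ∉ B ∧ ∃ u ∈ B, G.Adj u v}

lemma mem_outerBoundary {D B : Finset V} {v : V} :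
    v ∈ outerBoundary G D B ↔ v ∈ D ∧ v ∉ B ∧ ∃ u ∈ B, G.Adj u v := by
  simp [outerBoundary]

lemma outerBoundary_subset (D B : Finset V) : outerBoundary G D B ⊆ D :=
  fun _ h => (mem_outerBoundary.1 h).1

lemma disjoint_outerBoundary (D B : Finset V) : Disjoint B (outerBoundary G D B) :=
  disjoint_right.2 fun _ h => (mem_outerBoundary.1 h).2.1

/-- The ball of radius `j` around `A` in the subgraph induced by `D`. -/
noncomputable def ballIn (G : SimpleGraph V) (D A : Finset V) : ℕ → Finset V
  | 0 => A
  | j + 1 => ballIn G D A j ∪ outerBoundary G D (ballIn G D A j)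

lemma ballIn_subset {D A : Finset V} (hA : A ⊆ D) (j : ℕ) : ballIn G D A j ⊆ D := by
  induction j with
  | zero => exact hA
  | succ j ih => exact union_subset ih (outerBoundary_subset _ _)

lemma subset_ballIn (D A : Finset V) (j : ℕ) : A ⊆ ballIn G D A j := by
  induction j with
  | zero => exact subset_rfl
  | succ j ih => exact ih.trans subset_union_left

lemma exists_walk_of_mem_ballIn {D A : Finset V} (hA : A ⊆ D) {j : ℕ} {v : V}
    (hv : v ∈ ballIn G D A j) :
    ∃ a ∈ A, ∃ p : G.Walk a v, p.length ≤ j ∧ ∀ x ∈ p.support, x ∈ D := by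
  induction j generalizing v with
  | zero => exact ⟨v, hv, .nil, le_rfl, by simpa using hA hv⟩
  | succ j ih =>
    rcases mem_union.1 hv with hv | hv
    · obtain ⟨a, ha, p, hp, hpD⟩ := ih hv
      exact ⟨a, ha, p, hp.trans (Nat.le_succ _), hpD⟩
    · obtain ⟨hvD, -, u, hu, huv⟩ := mem_outerBoundary.1 hv
      obtain ⟨a, ha, p, hp, hpD⟩ := ih hu
      refine ⟨a, ha, p.concat huv, by simpa using hp, fun x hx => ?_⟩
      rw [SimpleGraph.Walk.support_concat, List.mem_append, List.mem_singleton] at hx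
      rcases hx with hx | rfl
      · exact hpD x hx
      · exact hvD

/-- In a set without sparse cuts, balls grow until they contain more than half of the set. -/
lemma card_lt_two_mul_card_ballIn {D A : Finset V} {ε : ℝ} {R : ℕ} (hε : 0 ≤ ε)
    (hR : (D.card : ℝ) ≤ (1 + ε) ^ R)
    (hcut : ∀ B ⊆ D, B.Nonempty → 2 * B.card ≤ D.card →
      ε * B.card < (outerBoundary G D B).card)
    (hA : A ⊆ D) (hAne : A.Nonempty) : D.card < 2 * (ballIn G D A R).card := by
  -- As long as a ball has at most half of `D`, it is not a sparse cut, so the next ball is larger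
  -- by a factor of at least `1 + ε`.
  have key : ∀ j, D.card < 2 * (ballIn G D A j).card ∨
      (1 + ε) ^ j ≤ (ballIn G D A j).card := by
    intro j
    induction j with
    | zero => exact .inr (by simpa [ballIn] using hAne)
    | succ j ih =>
      have hcard : (ballIn G D A (j + 1)).card =
          (ballIn G D A j).card + (outerBoundary G D (ballIn G D A j)).card :=
        card_union_of_disjoint (disjoint_outerBoundary _ _)
      by_cases hlt : D.card < 2 * (ballIn G D A j).card
      · exact .inl (by omega)
      · right
        have h1 := ih.resolve_left hlt
        have h2 := hcut _ (ballIn_subset hA j) (hAne.mono (subset_ballIn D A j)) (not_lt.1 hlt)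
        rw [hcard, pow_succ]
        push_cast
        nlinarith
  rcases key R with h | h
  · exact h
  · have h1 : (D.card : ℝ) ≤ (ballIn G D A R).card := hR.trans h
    have h2 : D.card ≤ (ballIn G D A R).card := by exact_mod_cast h1
    have h3 : 0 < D.card := (hAne.mono hA).card_pos
    omega

/-- A set without sparse cuts contains a shallow set that meets each of a given family of
subsets. -/
lemma exists_shallowSet {D : Finset V} {ε : ℝ} {R : ℕ} (hε : 0 ≤ ε) (hD : D.Nonempty)
    (hR : (D.card : ℝ) ≤ (1 + ε) ^ R)
    (hcut : ∀ B ⊆ D, B.Nonempty → 2 * B.card ≤ D.card →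
      ε * B.card < (outerBoundary G D B).card)
    (𝒜 : Finset (Finset V)) (h𝒜 : ∀ A ∈ 𝒜, A ⊆ D ∧ A.Nonempty) :
    ∃ X ⊆ D, IsShallowSet G (2 * R) X ∧ X.card ≤ 2 * 𝒜.card * R + 1 ∧
      ∀ A ∈ 𝒜, ∃ a ∈ A, a ∈ X := by
  obtain ⟨v, hv⟩ := hD
  have hvD : ({v} : Finset V) ⊆ D := singleton_subset_iff.2 hv
  have hpath : ∀ A ∈ 𝒜, ∃ Y ⊆ D, v ∈ Y ∧ Y.card ≤ 2 * R + 1 ∧ (∃ a ∈ A, a ∈ Y) ∧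
      ∀ u ∈ Y, ∃ p : G.Walk v u, p.length ≤ 2 * R ∧ ∀ x ∈ p.support, x ∈ Y := by
    intro A hA
    have h1 := card_lt_two_mul_card_ballIn hε hR hcut hvD (singleton_nonempty v)
    have h2 := card_lt_two_mul_card_ballIn hε hR hcut (h𝒜 A hA).1 (h𝒜 A hA).2
    -- Two subsets of `D`, each with more than half of its vertices, must meet.
    have h3 : ¬ Disjoint (ballIn G D {v} R) (ballIn G D A R) := fun h => by
      have := card_le_card (union_subset (ballIn_subset (G := G) hvD R)
        (ballIn_subset (G := G) (h𝒜 A hA).1 R))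
      rw [card_union_of_disjoint h] at this
      omega
    obtain ⟨u, hu, hu'⟩ := not_disjoint_iff.1 h3
    obtain ⟨v', hv', p, hp, hpD⟩ := exists_walk_of_mem_ballIn hvD hu
    obtain rfl := mem_singleton.1 hv'
    obtain ⟨a, ha, q, hq, hqD⟩ := exists_walk_of_mem_ballIn (h𝒜 A hA).1 hu'
    have hlen : (p.append q.reverse).length ≤ 2 * R := by
      rw [SimpleGraph.Walk.length_append, SimpleGraph.Walk.length_reverse]
      omega
    refine ⟨(p.append q.reverse).support.toFinset, fun x hx => ?_, by simp, ?_, ⟨a, ha, by simp⟩,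
      fun x hx => ?_⟩
    · rw [List.mem_toFinset, SimpleGraph.Walk.mem_support_append_iff,
        SimpleGraph.Walk.support_reverse, List.mem_reverse] at hx
      exact hx.elim (hpD x) (hqD x)
    · refine (List.toFinset_card_le _).trans ?_
      rw [SimpleGraph.Walk.length_support]
      omega
    · rw [List.mem_toFinset] at hx
      exact ⟨_, (SimpleGraph.Walk.length_takeUntil_le_length _ hx).trans hlen, fun y hy =>
        List.mem_toFinset.2 (SimpleGraph.Walk.support_takeUntil_subset_support _ hx hy)⟩
  choose! Y hYD hvY hYcard hYA hYwalk using hpath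
  -- All paths share `v`, so each adds at most `2 * R` further vertices.
  refine ⟨insert v (𝒜.biUnion fun A => (Y A).erase v), ?_, ?_, ?_, ?_⟩
  · exact insert_subset hv (biUnion_subset.2 fun A hA => (erase_subset _ _).trans (hYD A hA))
  · refine ⟨v, mem_insert_self _ _, fun u hu => ?_⟩
    rcases mem_insert.1 hu with rfl | hu
    · exact ⟨.nil, Nat.zero_le _, by simp⟩
    · obtain ⟨A, hA, hu⟩ := mem_biUnion.1 hu
      obtain ⟨p, hp, hpY⟩ := hYwalk A hA u (mem_of_mem_erase hu)
      refine ⟨p, hp, fun x hx => ?_⟩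
      by_cases hxv : x = v
      · simp [hxv]
      · exact mem_insert_of_mem (mem_biUnion.2 ⟨A, hA, mem_erase.2 ⟨hxv, hpY x hx⟩⟩)
  · refine (card_insert_le _ _).trans (Nat.add_le_add_right (card_biUnion_le.trans ?_) 1)
    refine (sum_le_card_nsmul _ _ (2 * R) fun A hA => ?_).trans
      (by rw [smul_eq_mul, ← mul_assoc, mul_comm 𝒜.card])
    rw [card_erase_of_mem (hvY A hA)]
    have := hYcard A hA
    omega
  · intro A hA
    obtain ⟨a, ha, haY⟩ := hYA A hA
    refine ⟨a, ha, ?_⟩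
    by_cases hav : a = v
    · simp [hav]
    · exact mem_insert_of_mem (mem_biUnion.2 ⟨A, hA, mem_erase.2 ⟨hav, haY⟩⟩)

end BallGrowing

/-! ### The recursion for decompositions and for separators -/

section Recursion

variable {V : Type*} [Fintype V] {G : SimpleGraph V}

/-- A set of vertices that is closed under adjacency away from `T` contains or is disjoint from
each component of `G - T`. -/
lemma supp_subset_or_disjoint {T : Set V} {A : Finset V}
    (hA : ∀ u ∈ A, ∀ v, G.Adj u v → v ∈ A ∨ v ∈ T)
    (C : (G.induce Tᶜ).ConnectedComponent) :
    (∀ x ∈ C.supp, x.1 ∈ A) ∨ ∀ x ∈ C.supp, x.1 ∉ A := by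
  have key : ∀ {x y : (Tᶜ : Set V)}, (G.induce Tᶜ).Walk x y → x.1 ∈ A → y.1 ∈ A := by
    intro x y p
    induction p with
    | nil => exact id
    | @cons x z y h p ih =>
      exact fun hx => ih ((hA _ hx _ h).resolve_right z.2)
  by_cases h : ∃ x ∈ C.supp, x.1 ∈ A
  · obtain ⟨x, hx, hxA⟩ := h
    refine .inl fun y hy => ?_
    obtain ⟨p⟩ := SimpleGraph.ConnectedComponent.exact (hx.trans hy.symm)
    exact key p hxA
  · exact .inr fun x hx hxA => h ⟨x, hx, hxA⟩

lemma ncard_supp_le {T : Set V} {A : Finset V} (C : (G.induce Tᶜ).ConnectedComponent)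
    (h : ∀ x ∈ C.supp, x.1 ∈ A) : C.supp.ncard ≤ A.card := by
  rw [← Set.ncard_coe_finset]
  exact Set.ncard_le_ncard_of_injOn Subtype.val h Subtype.val_injective.injOn (Set.toFinite _)

variable [DecidableEq V]

/-- A set of vertices that sees all parts of a clique model has a sparse cut or contains a further
part of the model. -/
lemma exists_cut_or_shallowSet {D : Finset V} {S : Finset (Finset V)} {ε : ℝ} {R : ℕ} (hε : 0 ≤ ε)
    (hD : D.Nonempty) (hR : (Fintype.card V : ℝ) ≤ (1 + ε) ^ R)
    (hadj : ∀ P ∈ S, ∃ u ∈ P, ∃ v ∈ D, G.Adj u v) :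
    (∃ B ⊆ D, B.Nonempty ∧ 2 * B.card ≤ D.card ∧ ((outerBoundary G D B).card : ℝ) ≤ ε * B.card) ∨
    ∃ X ⊆ D, IsShallowSet G (2 * R) X ∧ X.card ≤ 2 * S.card * R + 1 ∧
      ∀ P ∈ S, ∃ u ∈ P, ∃ v ∈ X, G.Adj u v := by
  classical
  by_cases hcut : ∃ B ⊆ D, B.Nonempty ∧ 2 * B.card ≤ D.card ∧
      ((outerBoundary G D B).card : ℝ) ≤ ε * B.card
  · exact .inl hcut
  right
  push Not at hcut
  have hDV : (D.card : ℝ) ≤ (1 + ε) ^ R :=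
    le_trans (by exact_mod_cast card_le_univ D) hR
  obtain ⟨X, hXD, hX, hXcard, hXA⟩ := exists_shallowSet hε hD hDV hcut
    (S.image fun P => D.filter fun v => ∃ u ∈ P, G.Adj u v) (by
      intro A hA
      obtain ⟨P, hP, rfl⟩ := mem_image.1 hA
      obtain ⟨u, hu, v, hv, huv⟩ := hadj P hP
      exact ⟨filter_subset _ _, v, mem_filter.2 ⟨hv, u, hu, huv⟩⟩)
  refine ⟨X, hXD, hX, hXcard.trans ?_, fun P hP => ?_⟩
  · exact Nat.add_le_add_right (Nat.mul_le_mul_right _ (Nat.mul_le_mul_left _ card_image_le)) 1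
  · obtain ⟨v, hv, hvX⟩ := hXA _ (mem_image_of_mem _ hP)
    obtain ⟨u, hu, huv⟩ := (mem_filter.1 hv).2
    exact ⟨u, hu, v, hvX, huv⟩

/-- The recursion: a set `D` has a part decomposition, attached to a clique model `S`, after the
deletion of a small set `Z`. -/
lemma exists_hasPartDecomposition_sdiff {w : Finset V → ℝ} {F : ℝ → ℝ} {ε : ℝ} {R t s m m₀ : ℕ}
    (hw : ∀ P, 0 ≤ w P) (hF : Monotone F) (hε : 0 ≤ ε)
    (hR : (Fintype.card V : ℝ) ≤ (1 + ε) ^ R) (hs : 2 * t * R + 1 ≤ s) (hsm : s ≤ m)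
    (hm₀ : m₀ ≤ m) (ht : ∀ S, IsCliqueModel G (2 * R) s S → S.card ≤ t)
    (hmodel : ∀ S, IsCliqueModel G (2 * R) s S → ∑ P ∈ S, w P ≤ F 0)
    (hleaf : ∀ S (D : Finset V), IsCliqueModel G (2 * R) s S → D.Nonempty → D.card ≤ m₀ →
      ∑ P ∈ insert D S, w P ≤ F 0)
    (hchunk : ∀ (Z : Finset V) (N : ℝ), m₀ < N → (Z.card : ℝ) ≤ ε * N →
      ∃ Q : Finset (Finset V), (∀ P ∈ Q, P.Nonempty) ∧ (∀ P ∈ Q, P.card ≤ m) ∧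
        (∀ P ∈ Q, ∀ P' ∈ Q, P ≠ P' → Disjoint P P') ∧ (∀ v, v ∈ Z ↔ ∃ P ∈ Q, v ∈ P) ∧
        ∑ P ∈ Q, w P ≤ F N - F (N / 2)) (k : ℕ) :
    ∀ (D : Finset V) (S : Finset (Finset V)), 2 * D.card + S.card ≤ k →
      IsCliqueModel G (2 * R) s S → (∀ P ∈ S, Disjoint P D) →
      (∃ Z ⊆ D, (Z.card : ℝ) ≤ ε * D.card ∧ (D.card ≤ m₀ → Z = ∅) ∧
        HasPartDecomposition G w m (D \ Z) S (F (D.card / 2))) ∧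
      HasPartDecomposition G w m D S (F D.card) := by
  -- In the measure `2|D| + |S|`, moving a nonempty `X` from `D` into `S` loses at least 2 and gains
  -- at most 1; dropping a set of `S` loses 1.
  induction k using Nat.strong_induction_on with
  | _ k ih =>
  intro D S hk hS hSD
  have hSD' : ∀ P ∈ S, P.Nonempty ∧ Disjoint P D := fun P hP =>
    ⟨(hS.shallow P hP).nonempty, hSD P hP⟩
  have hF0 : F 0 ≤ F (D.card / 2) := hF (by positivity)
  -- The second conclusion follows from the first by returning `Z` to all bags, at cost `F N - F (N
  -- / 2)` for `N = |D|`.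
  suffices hmain : ∃ Z ⊆ D, (Z.card : ℝ) ≤ ε * D.card ∧ (D.card ≤ m₀ → Z = ∅) ∧
      HasPartDecomposition G w m (D \ Z) S (F (D.card / 2)) by
    refine ⟨hmain, ?_⟩
    obtain ⟨Z, hZD, hZcard, hZ0, hZ⟩ := hmain
    by_cases hDm : D.card ≤ m₀
    · rw [hZ0 hDm, sdiff_empty] at hZ
      exact hZ.mono (hF (half_le_self (Nat.cast_nonneg _)))
    · obtain ⟨Q, hQne, hQm, hQd, hQZ, hQw⟩ := hchunk Z D.card (by exact_mod_cast not_le.1 hDm) hZcard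
      exact (hZ.add_parts hw hZD hQne hQm hQd hQZ hQw hSD').mono (by linarith)
  rcases D.eq_empty_or_nonempty with rfl | hDne
  · exact ⟨∅, subset_rfl, by simp, fun _ => rfl, by
      simpa using hasPartDecomposition_empty (hmodel S hS)⟩
  by_cases hDm : D.card ≤ m₀
  · refine ⟨∅, empty_subset _, by simpa using mul_nonneg hε (Nat.cast_nonneg _), fun _ => rfl, ?_⟩
    rw [sdiff_empty]
    refine HasPartDecomposition.of_insert (X := D) ?_ subset_rfl hDne (hDm.trans hm₀) hSD'
    rw [sdiff_self]
    exact (hasPartDecomposition_empty (hleaf S D hS hDne hDm)).mono hF0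
  by_cases hadj : ∀ P ∈ S, ∃ u ∈ P, ∃ v ∈ D, G.Adj u v
  · rcases exists_cut_or_shallowSet hε hDne hR hadj with
      ⟨B, hBD, hBne, hBcard, hBcut⟩ | ⟨X, hXD, hX, hXcard, hXadj⟩
    · set Z := outerBoundary G D B with hZdef
      have hZD : Z ⊆ D := outerBoundary_subset _ _
      have hBZ : Disjoint B Z := disjoint_outerBoundary _ _
      have hBpos := hBne.card_pos
      have hcards : (D \ (B ∪ Z)).card + (B.card + Z.card) = D.card := by
        rw [← card_union_of_disjoint hBZ]
        exact card_sdiff_add_card_eq_card (union_subset hBD hZD)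
      -- The small side is decomposed completely, as `F |B| ≤ F (|D| / 2)`. The large side keeps its
      -- removed set `Y`, which joins `Z`: `ε|B| + ε|D \ (B ∪ Z)| ≤ ε|D|`.
      have hBdec := (ih (2 * B.card + S.card) (by omega) B S le_rfl hS
        fun P hP => (hSD P hP).mono_right hBD).2
      obtain ⟨Y, hYD, hYcard, -, hY⟩ := (ih (2 * (D \ (B ∪ Z)).card + S.card) (by omega)
        (D \ (B ∪ Z)) S le_rfl hS fun P hP => (hSD P hP).mono_right sdiff_subset).1
      have hBhalf : (B.card : ℝ) ≤ D.card / 2 := by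
        have : (2 * B.card : ℝ) ≤ D.card := by exact_mod_cast hBcard
        linarith
      have hcards' : ((D \ (B ∪ Z)).card : ℝ) + (B.card + Z.card) = D.card := by
        exact_mod_cast hcards
      have hYB : Disjoint Y B :=
        (sdiff_disjoint.mono_left hYD).mono_right subset_union_left
      have hset : D \ (Z ∪ Y) = B ∪ ((D \ (B ∪ Z)) \ Y) := by
        ext v
        simp only [mem_sdiff, mem_union]
        constructor
        · tauto
        · rintro (hv | hv)
          · exact ⟨hBD hv, fun h => h.elim (disjoint_left.1 hBZ hv) (disjoint_right.1 hYB hv)⟩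
          · tauto
      refine ⟨Z ∪ Y, union_subset hZD (hYD.trans sdiff_subset), ?_, fun h => absurd h hDm, ?_⟩
      · have h1 : ((Z ∪ Y).card : ℝ) ≤ Z.card + Y.card := by exact_mod_cast card_union_le _ _
        have h2 : 0 ≤ ε * Z.card := by positivity
        rw [← hcards']
        linarith
      · rw [hset]
        refine (hBdec.mono (hF hBhalf)).glue (hY.mono (hF ?_)) subset_rfl ?_ ?_ ?_ ?_
        · gcongr
          exact sdiff_subset
        · exact disjoint_sdiff.mono subset_union_left sdiff_subset
        · intro u hu v hv huv
          obtain ⟨hvD, hvBZ⟩ := mem_sdiff.1 (mem_sdiff.1 hv).1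
          rw [mem_union, not_or] at hvBZ
          exact hvBZ.2 (mem_outerBoundary.2 ⟨hvD, hvBZ.1, u, hu, huv⟩)
        · exact fun P hP hP' => absurd hP hP'
        · rw [← hset]
          exact fun P hP => ⟨(hSD' P hP).1, (hSD P hP).mono_right sdiff_subset⟩
    · have hXs : X.card ≤ s := hXcard.trans (le_trans (by gcongr; exact ht S hS) hs)
      have hS' := hS.insert hX hXs (fun P hP => (hSD P hP).mono_right hXD) hXadj
      have hXpos := hX.nonempty.card_pos
      have hc1 := card_sdiff_add_card_eq_card hXD
      have hc2 := card_insert_le X S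
      obtain ⟨Z, hZD, hZcard, -, hZ⟩ := (ih (2 * (D \ X).card + (insert X S).card) (by omega)
        (D \ X) (insert X S) le_rfl hS' (by
          intro P hP
          rcases mem_insert.1 hP with rfl | hP
          · exact disjoint_sdiff
          · exact (hSD P hP).mono_right sdiff_subset)).1
      refine ⟨Z, hZD.trans sdiff_subset, hZcard.trans ?_, fun h => absurd h hDm, ?_⟩
      · gcongr
        exact sdiff_subset
      · have hXZ : X ⊆ D \ Z := fun v hv =>
          mem_sdiff.2 ⟨hXD hv, fun h => (mem_sdiff.1 (hZD h)).2 hv⟩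
        refine HasPartDecomposition.of_insert (X := X) ?_ hXZ hX.nonempty (hXs.trans hsm)
          fun P hP => ⟨(hSD' P hP).1, (hSD P hP).mono_right sdiff_subset⟩
        rw [sdiff_right_comm]
        refine hZ.mono (hF ?_)
        gcongr
        exact sdiff_subset
  · push Not at hadj
    obtain ⟨P, hP, hPadj⟩ := hadj
    have hc := card_erase_add_one hP
    obtain ⟨Z, hZD, hZcard, -, hZ⟩ := (ih (2 * D.card + (S.erase P).card) (by omega)
      D (S.erase P) le_rfl (hS.subset (erase_subset _ _))
      fun P hP => hSD P (mem_of_mem_erase hP)).1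
    refine ⟨Z, hZD, hZcard, fun h => absurd h hDm, ?_⟩
    -- A new root with bag `S` is attached to the decomposition for `S.erase P`, since no edge joins
    -- `P` to `D`.
    have h := (hasPartDecomposition_empty (G := G) (m := m) ((hmodel S hS).trans hF0)).glue hZ
      (erase_subset _ _) (disjoint_empty_left _) (by simp) ?_ ?_
    · simpa using h
    · intro P' hP' hP'' u hu v hv huv
      obtain rfl : P' = P := by
        by_contra hne
        exact hP'' (mem_erase.2 ⟨hne, hP'⟩)
      exact hPadj v hv u (mem_sdiff.1 hu).1 huv.symm
    · intro P' hP'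
      rw [empty_union]
      exact ⟨(hSD' P' hP').1, (hSD P' hP').mono_right sdiff_subset⟩

/-- A balanced separator that consists of the parts of a clique model and a small set. -/
lemma exists_isBalancedSeparator {ε : ℝ} {R t s : ℕ} (hε : 0 ≤ ε)
    (hR : (Fintype.card V : ℝ) ≤ (1 + ε) ^ R) (hs : 2 * t * R + 1 ≤ s)
    (ht : ∀ S, IsCliqueModel G (2 * R) s S → S.card ≤ t) (k : ℕ) :
    ∀ (D Z : Finset V) (S : Finset (Finset V)), 2 * D.card + S.card ≤ k →
      IsCliqueModel G (2 * R) s S → (∀ P ∈ S, Disjoint P D) →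
      Fintype.card V < 2 * D.card → (Z.card : ℝ) + ε * D.card ≤ ε * Fintype.card V →
      (∀ u ∈ D, ∀ v, G.Adj u v → v ∈ D ∨ v ∈ Z ∨ v ∈ S.biUnion id) →
      ∃ T : Finset V, IsBalancedSeparator G T ∧ (T.card : ℝ) ≤ t * s + ε * Fintype.card V := by
  have hunion : ∀ S, IsCliqueModel G (2 * R) s S → (S.biUnion id).card ≤ t * s := fun S hS =>
    (card_biUnion_le_card_mul _ _ s hS.card_le).trans (Nat.mul_le_mul_right _ (ht S hS))
  have hbound : ∀ (Z : Finset V) S, IsCliqueModel G (2 * R) s S →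
      (Z.card : ℝ) ≤ ε * Fintype.card V →
      ((S.biUnion id ∪ Z).card : ℝ) ≤ t * s + ε * Fintype.card V := fun Z S hS hZ => by
    have h1 : ((S.biUnion id ∪ Z).card : ℝ) ≤ (S.biUnion id).card + Z.card := by
      exact_mod_cast card_union_le _ _
    have h2 : ((S.biUnion id).card : ℝ) ≤ t * s := by exact_mod_cast hunion S hS
    linarith
  have hcompl : ∀ (A : Finset V) (T : Set V) (C : (G.induce Tᶜ).ConnectedComponent),
      Fintype.card V ≤ 2 * A.card → (∀ x ∈ C.supp, x.1 ∉ A) →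
      (C.supp.ncard : ℝ) ≤ (Fintype.card V : ℝ) / 2 := fun A T C hA hC => by
    have h1 := ncard_supp_le (A := Aᶜ) C fun x hx => mem_compl.2 (hC x hx)
    have h2 := A.card_add_card_compl
    have h3 : 2 * C.supp.ncard ≤ Fintype.card V := by omega
    have h4 : (2 * C.supp.ncard : ℝ) ≤ Fintype.card V := by exact_mod_cast h3
    linarith
  have hsmall : ∀ (A : Finset V) (T : Set V) (C : (G.induce Tᶜ).ConnectedComponent),
      2 * A.card ≤ Fintype.card V → (∀ x ∈ C.supp, x.1 ∈ A) →
      (C.supp.ncard : ℝ) ≤ (Fintype.card V : ℝ) / 2 := fun A T C hA hC => by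
    have h1 := ncard_supp_le C hC
    have h3 : 2 * C.supp.ncard ≤ Fintype.card V := by omega
    have h4 : (2 * C.supp.ncard : ℝ) ≤ Fintype.card V := by exact_mod_cast h3
    linarith
  -- The recursion keeps `D` above half of `V`, with all neighbours outside `D` in `Z` or in the
  -- model, and ends when `D` would drop to at most half. The budget `|Z| + ε|D| ≤ ε|V|` persists
  -- because a cut adds at most `ε|B|` to `Z` and takes `B` from `D`.
  induction k using Nat.strong_induction_on with
  | _ k ih =>
  intro D Z S hk hS hSD hhalf hZ hnbr
  have hDne : D.Nonempty := card_pos.1 (by omega)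
  by_cases hadj : ∀ P ∈ S, ∃ u ∈ P, ∃ v ∈ D, G.Adj u v
  · rcases exists_cut_or_shallowSet hε hDne hR hadj with
      ⟨B, hBD, hBne, hBcard, hBcut⟩ | ⟨X, hXD, hX, hXcard, hXadj⟩
    · set Y := outerBoundary G D B with hYdef
      have hYD : Y ⊆ D := outerBoundary_subset _ _
      have hBY : Disjoint B Y := disjoint_outerBoundary _ _
      have hBpos := hBne.card_pos
      have hcards : (D \ (B ∪ Y)).card + (B.card + Y.card) = D.card := by
        rw [← card_union_of_disjoint hBY]
        exact card_sdiff_add_card_eq_card (union_subset hBD hYD)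
      have hcards' : ((D \ (B ∪ Y)).card : ℝ) + (B.card + Y.card) = D.card := by
        exact_mod_cast hcards
      have hZY : ((Z ∪ Y).card : ℝ) + ε * (D \ (B ∪ Y)).card ≤ ε * Fintype.card V := by
        have h1 : ((Z ∪ Y).card : ℝ) ≤ Z.card + Y.card := by exact_mod_cast card_union_le _ _
        have h2 : 0 ≤ ε * Y.card := by positivity
        have h3 : ε * D.card = ε * (D \ (B ∪ Y)).card + (ε * B.card + ε * Y.card) := by
          rw [← hcards']; ring
        linarith
      have hnbrD : ∀ u ∈ D \ (B ∪ Y), ∀ v, G.Adj u v →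
          v ∈ D \ (B ∪ Y) ∨ v ∈ Z ∪ Y ∨ v ∈ S.biUnion id := by
        intro u hu v huv
        obtain ⟨huD, huBY⟩ := mem_sdiff.1 hu
        rw [mem_union, not_or] at huBY
        rcases hnbr u huD v huv with hv | hv | hv
        · by_cases hvB : v ∈ B
          · exact absurd (mem_outerBoundary.2 ⟨huD, huBY.1, v, hvB, huv.symm⟩) huBY.2
          · by_cases hvY : v ∈ Y
            · exact .inr (.inl (mem_union_right _ hvY))
            · exact .inl (by simp [hv, hvB, hvY])
        · exact .inr (.inl (mem_union_left _ hv))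
        · exact .inr (.inr hv)
      by_cases hD' : Fintype.card V < 2 * (D \ (B ∪ Y)).card
      · exact ih (2 * (D \ (B ∪ Y)).card + S.card) (by omega) _ _ S le_rfl hS
          (fun P hP => (hSD P hP).mono_right sdiff_subset) hD' hZY hnbrD
      · refine ⟨S.biUnion id ∪ (Z ∪ Y), fun C => ?_, hbound _ S hS
          (le_trans (le_add_of_nonneg_right (by positivity)) hZY)⟩
        have hmem : ∀ x : (((S.biUnion id ∪ (Z ∪ Y) : Finset V) : Set V)ᶜ : Set V), x.1 ∉ Y :=
          fun x hx => x.2 (by simp [hx])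
        rcases supp_subset_or_disjoint (A := D \ (B ∪ Y)) (fun u hu v huv =>
          (hnbrD u hu v huv).imp_right fun h => mem_coe.2 <| by
            rw [mem_union]; exact h.symm) C with h | hCD
        · exact hsmall _ _ C (not_lt.1 hD') h
        rcases supp_subset_or_disjoint (A := B) (fun u hu v huv => by
          by_cases hvB : v ∈ B
          · exact .inl hvB
          · right
            rw [mem_coe, mem_union, mem_union]
            rcases hnbr u (hBD hu) v huv with hv | hv | hv
            · exact .inr (.inr (mem_outerBoundary.2 ⟨hv, hvB, u, hu, huv⟩))
            · exact .inr (.inl hv)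
            · exact .inl hv) C with h | hCB
        · exact hsmall B _ C (hBcard.trans (card_le_univ D)) h
        -- A component avoiding both sides of the cut and its boundary avoids all of `D`, hence has
        -- less than half of the vertices.
        · refine hcompl D _ C hhalf.le fun x hx hxD => ?_
          exact hCD x hx (by simp [hxD, hCB x hx, hmem x])
    · have hXs : X.card ≤ s := hXcard.trans (le_trans (by gcongr; exact ht S hS) hs)
      have hS' := hS.insert hX hXs (fun P hP => (hSD P hP).mono_right hXD) hXadj
      have hXpos := hX.nonempty.card_pos
      have hc1 := card_sdiff_add_card_eq_card hXD
      have hc2 := card_insert_le X S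
      have hbi : (insert X S).biUnion id = X ∪ S.biUnion id := by rw [biUnion_insert]; rfl
      have hZ' : (Z.card : ℝ) + ε * (D \ X).card ≤ ε * Fintype.card V := by
        refine le_trans ?_ hZ
        gcongr
        exact sdiff_subset
      have hnbrD : ∀ u ∈ D \ X, ∀ v, G.Adj u v →
          v ∈ D \ X ∨ v ∈ Z ∨ v ∈ (insert X S).biUnion id := by
        intro u hu v huv
        rw [hbi, mem_union, mem_sdiff]
        have := hnbr u (mem_sdiff.1 hu).1 v huv
        tauto
      by_cases hD' : Fintype.card V < 2 * (D \ X).card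
      · refine ih (2 * (D \ X).card + (insert X S).card) (by omega) (D \ X) Z (insert X S) le_rfl
          hS' (fun P hP => ?_) hD' hZ' hnbrD
        rcases mem_insert.1 hP with rfl | hP
        · exact disjoint_sdiff
        · exact (hSD P hP).mono_right sdiff_subset
      · refine ⟨(insert X S).biUnion id ∪ Z, fun C => ?_, hbound _ _ hS'
          (le_trans (le_add_of_nonneg_right (by positivity)) hZ)⟩
        have hmem : ∀ x : ((((insert X S).biUnion id ∪ Z : Finset V) : Set V)ᶜ : Set V), x.1 ∉ X :=
          fun x hx => x.2 <|
            mem_coe.2 (mem_union_left _ (mem_biUnion.2 ⟨X, mem_insert_self _ _, hx⟩))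
        rcases supp_subset_or_disjoint (A := D \ X) (fun u hu v huv =>
          (hnbrD u hu v huv).imp_right fun h => mem_coe.2 <| by
            rw [mem_union]; exact h.symm) C with h | hCD
        · exact hsmall _ _ C (not_lt.1 hD') h
        · exact hcompl D _ C hhalf.le fun x hx hxD =>
            hCD x hx (mem_sdiff.2 ⟨hxD, hmem x⟩)
  · push Not at hadj
    obtain ⟨P, hP, hPadj⟩ := hadj
    have hc := card_erase_add_one hP
    refine ih (2 * D.card + (S.erase P).card) (by omega) D Z (S.erase P) le_rfl
      (hS.subset (erase_subset _ _)) (fun P hP => hSD P (mem_of_mem_erase hP)) hhalf hZ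
      fun u hu v huv => (hnbr u hu v huv).imp_right (Or.imp_right fun h => ?_)
    obtain ⟨P', hP', hv⟩ := mem_biUnion.1 h
    refine mem_biUnion.2 ⟨P', mem_erase.2 ⟨?_, hP'⟩, hv⟩
    rintro rfl
    exact hPadj v hv u hu huv.symm

end Recursion

/-! ### The recursion with its two weights -/

section Consequences

variable {V : Type*} {G : SimpleGraph V}

lemma isCliqueModel_empty (r s : ℕ) : IsCliqueModel G r s ∅ :=
  ⟨by simp, by simp, by simp, by simp⟩

/-- A finite set has a partition into few parts of size at most `m`. -/
lemma exists_chunks {m : ℕ} (hm : 0 < m) (Z : Finset V) :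
    ∃ Q : Finset (Finset V), (∀ P ∈ Q, P.Nonempty) ∧ (∀ P ∈ Q, P.card ≤ m) ∧
      (∀ P ∈ Q, ∀ P' ∈ Q, P ≠ P' → Disjoint P P') ∧ (∀ v, v ∈ Z ↔ ∃ P ∈ Q, v ∈ P) ∧
      Q.card * m ≤ Z.card + m := by
  classical
  induction hk : Z.card using Nat.strong_induction_on generalizing Z with
  | _ k ih =>
  rcases Z.eq_empty_or_nonempty with rfl | hZ
  · exact ⟨∅, by simp⟩
  by_cases hZm : Z.card ≤ m
  · refine ⟨{Z}, by simpa using hZ, by simpa using hZm, ?_, by simp, by simp⟩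
    simp only [mem_singleton]
    rintro P rfl P' rfl h
    exact absurd rfl h
  · obtain ⟨Y, hYZ, hY⟩ := exists_subset_card_eq (not_le.1 hZm).le
    have hc := card_sdiff_add_card_eq_card hYZ
    obtain ⟨Q, hQne, hQm, hQd, hQZ, hQc⟩ := ih (Z \ Y).card (by omega) (Z \ Y) rfl
    have hQY : ∀ P ∈ Q, Disjoint P Y := fun P hP =>
      disjoint_left.2 fun v hv => (mem_sdiff.1 ((hQZ v).2 ⟨P, hP, hv⟩)).2
    refine ⟨insert Y Q, ?_, ?_, ?_, fun v => ?_, ?_⟩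
    · simpa using ⟨card_pos.1 (hY ▸ hm), hQne⟩
    · simpa using ⟨hY.le, hQm⟩
    · intro P hP P' hP' hne
      rcases mem_insert.1 hP with h | h <;> rcases mem_insert.1 hP' with h' | h'
      · exact absurd (h.trans h'.symm) hne
      · exact h ▸ (hQY P' h').symm
      · exact h' ▸ hQY P h
      · exact hQd P h P' h' hne
    · have := hQZ v
      rw [mem_sdiff] at this
      by_cases hvY : v ∈ Y
      · exact ⟨fun _ => ⟨Y, mem_insert_self _ _, hvY⟩, fun _ => hYZ hvY⟩
      · constructor
        · intro hv
          obtain ⟨P, hP, hvP⟩ := this.1 ⟨hv, hvY⟩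
          exact ⟨P, mem_insert_of_mem hP, hvP⟩
        · rintro ⟨P, hP, hvP⟩
          rcases mem_insert.1 hP with rfl | hP
          · exact absurd hvP hvY
          · exact (this.2 ⟨P, hP, hvP⟩).1
    · have h := card_insert_le Y Q
      nlinarith

variable [Fintype V]

/-- A tree-decomposition with small bags. -/
lemma hasBagSizeAtMost_floor {ε : ℝ} {R t s : ℕ} (hε : 0 ≤ ε)
    (hR : (Fintype.card V : ℝ) ≤ (1 + ε) ^ R) (hs : 2 * t * R + 1 ≤ s)
    (ht : ∀ S, IsCliqueModel G (2 * R) s S → S.card ≤ t) :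
    HasBagSizeAtMost G ⌊(t * s + 2 * ε * Fintype.card V : ℝ)⌋₊ := by
  classical
  have hmodel : ∀ S, IsCliqueModel G (2 * R) s S → ∑ P ∈ S, (P.card : ℝ) ≤ t * s := fun S hS => by
    have h1 : ∑ P ∈ S, P.card ≤ S.card * s := sum_le_card_nsmul _ _ _ hS.card_le
    have h2 := h1.trans (Nat.mul_le_mul_right s (ht S hS))
    exact_mod_cast h2
  -- Here part sizes are irrelevant, so `m` is at least `|V|` and `Z` is a single part. With `m₀ =
  -- 0` the leaf case is vacuous, and `F N - F (N / 2) = ε * N` pays for `Z`.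
  have h := (exists_hasPartDecomposition_sdiff (G := G) (w := fun P => (P.card : ℝ))
    (F := fun N => t * s + 2 * ε * N) (ε := ε) (R := R) (t := t) (s := s)
    (m := max s (Fintype.card V)) (m₀ := 0) (fun P => Nat.cast_nonneg _)
    (fun x y hxy => by dsimp only; gcongr) hε hR hs (le_max_left _ _) (Nat.zero_le _) ht
    (by simpa using hmodel)
    (fun S D _ hD hD0 => absurd hD.card_pos (by omega))
    (fun Z N _ hZ => ?_)
    (2 * (univ : Finset V).card + (∅ : Finset (Finset V)).card) univ ∅ le_rfl
    (isCliqueModel_empty _ _) (by simp)).2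
  · simpa using h.hasBagSizeAtMost
  · have hN : (Z.card : ℝ) ≤ t * s + 2 * ε * N - (t * s + 2 * ε * (N / 2)) := by linarith
    rcases Z.eq_empty_or_nonempty with rfl | hZne
    · exact ⟨∅, by simp, by simp, by simp, by simp, by simpa using hN⟩
    · refine ⟨{Z}, by simpa using hZne, by simpa using .inr (card_le_univ Z), ?_, by simp,
        by simpa using hN⟩
      simp only [mem_singleton]
      rintro P rfl P' rfl h
      exact absurd rfl h

/-- Containment in a strong product with a complete graph. -/
lemma exists_isContained_strongProduct {ε : ℝ} {R t s m : ℕ} (hε : 0 ≤ ε)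
    (hR : (Fintype.card V : ℝ) ≤ (1 + ε) ^ R) (hs : 2 * t * R + 1 ≤ s) (hsm : s ≤ m)
    (ht : ∀ S, IsCliqueModel G (2 * R) s S → S.card ≤ t) :
    ∃ (W : Type) (_ : Fintype W) (H : SimpleGraph W),
      G.IsContained (strongProduct H (⊤ : SimpleGraph (Fin m))) ∧
      HasBagSizeAtMost H ⌊(t + 1 + 2 * ε * Fintype.card V / m +
        Real.logb 2 (max 1 (2 * Fintype.card V / m)) : ℝ)⌋₊ := by
  classical
  have hm : 0 < m := by omega
  have hm' : (0 : ℝ) < m := by exact_mod_cast hm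
  -- A leaf of at most `m` vertices is one part, whence `t + 1`. The linear term of `F` pays for the
  -- full chunks of `Z`, the logarithm for one rounding-up per halving.
  have h := (exists_hasPartDecomposition_sdiff (G := G) (w := fun _ => (1 : ℝ))
    (F := fun N => t + 1 + 2 * ε * N / m + Real.logb 2 (max 1 (2 * N / m))) (ε := ε) (R := R)
    (t := t) (s := s) (m := m) (m₀ := m) (fun P => zero_le_one)
    (fun x y hxy => ?_) hε hR hs hsm le_rfl ht
    (fun S hS => ?_) (fun S D hS _ _ => ?_) (fun Z N hN hZ => ?_)
    (2 * (univ : Finset V).card + (∅ : Finset (Finset V)).card) univ ∅ le_rfl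
    (isCliqueModel_empty _ _) (by simp)).2
  · simpa using h.exists_strongProduct
  · dsimp only
    have h1 : Real.logb 2 (max 1 (2 * x / m)) ≤ Real.logb 2 (max 1 (2 * y / m)) :=
      Real.logb_le_logb_of_le one_lt_two (by positivity) (by gcongr)
    have h2 : 2 * ε * x / m ≤ 2 * ε * y / m := by gcongr
    linarith
  · have : (S.card : ℝ) ≤ t := by exact_mod_cast ht S hS
    simp
    linarith
  · have h1 : ((insert D S).card : ℝ) ≤ t + 1 := by
      exact_mod_cast (card_insert_le D S).trans (Nat.add_le_add_right (ht S hS) 1)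
    simpa using h1
  · obtain ⟨Q, h1, h2, h3, h4, h5⟩ := exists_chunks hm Z
    refine ⟨Q, h1, h2, h3, h4, ?_⟩
    have hN1 : 1 ≤ N / m := (one_le_div hm').2 hN.le
    -- As `N > m`, halving `N` lowers the logarithm by exactly 1; the factor 2 inside keeps the
    -- truncation at 1 from interfering.
    have hlog : Real.logb 2 (max 1 (2 * N / m)) = 1 + Real.logb 2 (max 1 (2 * (N / 2) / m)) := by
      rw [show 2 * (N / 2) / m = N / m by ring, show 2 * N / m = 2 * (N / m) by ring,
        max_eq_right hN1, max_eq_right (by linarith), Real.logb_mul two_ne_zero (by positivity),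
        Real.logb_self_eq_one one_lt_two]
    have h6 : (Q.card : ℝ) * m ≤ ε * N + m := by
      have : (Q.card : ℝ) * m ≤ Z.card + m := by exact_mod_cast h5
      linarith
    have h7 : (Q.card : ℝ) ≤ ε * N / m + 1 := by
      have h := (le_div_iff₀ hm').2 h6
      rwa [add_div, div_self hm'.ne'] at h
    simp only [sum_const, nsmul_eq_mul, mul_one]
    rw [hlog]
    have h8 : 2 * ε * N / m - 2 * ε * (N / 2) / m = ε * N / m := by ring
    linarith

lemma exists_isContained_strongProduct_of_card_le {m : ℕ} (hV : Fintype.card V ≤ m)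
    (hpos : 0 < Fintype.card V) :
    ∃ (W : Type) (_ : Fintype W) (H : SimpleGraph W),
      G.IsContained (strongProduct H (⊤ : SimpleGraph (Fin m))) ∧ HasBagSizeAtMost H 1 := by
  classical
  have h : HasPartDecomposition G (fun _ => 1) m univ ∅ 1 := by
    refine HasPartDecomposition.of_insert (X := univ) ?_ subset_rfl (card_pos.1 hpos) hV (by simp)
    rw [sdiff_self]
    exact hasPartDecomposition_empty (by simp)
  simpa using h.exists_strongProduct

lemma separationNumber_le {ε : ℝ} {R t s : ℕ} (hε : 0 ≤ ε)
    (hR : (Fintype.card V : ℝ) ≤ (1 + ε) ^ R) (hs : 2 * t * R + 1 ≤ s)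
    (ht : ∀ S, IsCliqueModel G (2 * R) s S → S.card ≤ t) (hpos : 0 < Fintype.card V) :
    (separationNumber G : ℝ) ≤ t * s + ε * Fintype.card V := by
  classical
  obtain ⟨T, hT, hcard⟩ := exists_isBalancedSeparator hε hR hs ht _ univ ∅ ∅ le_rfl
    (isCliqueModel_empty _ _) (by simp) (by rw [card_univ]; omega) (by simp) (by simp)
  refine le_trans ?_ hcard
  have h : separationNumber G ≤ T.card := Nat.sInf_le ⟨T, hT, rfl⟩
  exact_mod_cast h

end Consequences

/-! ### Choice of parameters and estimates -/

section Numerics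

/-- Bernoulli's inequality for exponents in `[0, 1]` gives `2 ^ ε ≤ 1 + ε`. -/
lemma le_one_add_pow {ε x : ℝ} {R : ℕ} (hε : 0 ≤ ε) (hε1 : ε ≤ 1) (hx : 0 < x)
    (hR : Real.logb 2 x ≤ ε * R) : x ≤ (1 + ε) ^ R := by
  have h1 : (2 : ℝ) ^ ε ≤ 1 + ε := by
    have := rpow_one_add_le_one_add_mul_self (s := 1) (by norm_num) hε hε1
    norm_num at this
    exact this
  calc x = (2 : ℝ) ^ Real.logb 2 x := (Real.rpow_logb two_pos (by norm_num) hx).symm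
    _ ≤ (2 : ℝ) ^ (ε * R) := Real.rpow_le_rpow_of_exponent_le one_le_two hR
    _ = ((2 : ℝ) ^ ε) ^ R := Real.rpow_mul_natCast two_pos.le _ _
    _ ≤ (1 + ε) ^ R := by gcongr

/-- The choice of the parameters of the recursion: `Λ` is, up to a constant factor, the radius of
the parts of the clique models. -/
lemma exists_parameters {a c : ℝ} (ha : 0 < a) {V : Type*} [Fintype V]
    (G : SimpleGraph V) (hn : 2 ≤ Fintype.card V)
    (hω : ∀ r : ℕ, (shallowCliqueNumber r G : ℝ) ≤ c * ((r : ℝ) + 1) ^ a)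
    {L Λ : ℝ} (hL : L = Real.logb 2 (Fintype.card V)) (hL1 : 1 ≤ L) (hLΛ : L ≤ Λ) (hc : 1 ≤ c) :
    ∃ R t : ℕ, (Fintype.card V : ℝ) ≤ (1 + L / (2 * Λ)) ^ R ∧
      (∀ s S, IsCliqueModel G (2 * R) s S → S.card ≤ t) ∧
      2 * (R : ℝ) + 1 ≤ 7 * Λ ∧ (t : ℝ) ≤ c * 8 ^ a * Λ ^ a := by
  have hΛ : 0 < Λ := by linarith
  have hRub : (⌈2 * Λ⌉₊ : ℝ) < 2 * Λ + 1 := Nat.ceil_lt_add_one (by linarith)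
  have hRlb : 2 * Λ ≤ ⌈2 * Λ⌉₊ := Nat.le_ceil _
  refine ⟨⌈2 * Λ⌉₊, shallowCliqueNumber (2 * ⌈2 * Λ⌉₊) G, ?_,
    fun s S hS => hS.card_le_shallowCliqueNumber, by linarith, (hω _).trans ?_⟩
  · refine le_one_add_pow (by positivity) ?_ (by positivity) ?_
    · rw [div_le_one (by positivity)]
      linarith
    · rw [← hL, div_mul_eq_mul_div, le_div_iff₀ (by positivity)]
      gcongr
  · rw [mul_assoc, ← Real.mul_rpow (by norm_num) hΛ.le]
    gcongr
    push_cast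
    linarith

/-- The strong product for given parameters of the recursion, where `Λ` is up to a constant factor
the radius and `q * w` is the number of the parts of the clique models. No vertices have to be
deleted: the cut sets of the recursion are cut into parts of size at most `m`, and since they shrink
geometrically along the branches of the recursion, they add at most `q * w / 7 + L / 2` to the
tree-width of `H`. -/
lemma exists_strongProduct_of_parameters {V : Type*} [Fintype V] {G : SimpleGraph V}
    {n L Λ q w x y ε : ℝ} {R t : ℕ} (hn : n = Fintype.card V) (hn2 : 2 ≤ n)
    (hL : L = Real.logb 2 n) (hL1 : 1 ≤ L) (hΛ1 : 1 ≤ Λ) (hq1 : 1 ≤ q) (hw1 : 1 ≤ w) (hx1 : 1 ≤ x)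
    (hy : y ≤ √L) (hwxy : w = x * y) (hsqrt : w * Λ = √n * √L) (hε0 : 0 ≤ ε)
    (hεn : 2 * ε * n = w * w * Λ) (hR : n ≤ (1 + ε) ^ R)
    (ht : ∀ s S, IsCliqueModel G (2 * R) s S → S.card ≤ t) (hRΛ : 2 * (R : ℝ) + 1 ≤ 7 * Λ)
    (htw : (t : ℝ) ≤ q * w) :
    ∃ (W : Type) (_ : Fintype W) (H : SimpleGraph W) (m : ℕ),
      G.IsContained (strongProduct H (⊤ : SimpleGraph (Fin m))) ∧
      (treewidth H : ℝ) ≤ q * x * L ∧ (m : ℝ) ≤ 8 * (q * (w * Λ)) := by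
  have hn0 : 0 < n := by linarith
  have hL0 : 0 < L := by linarith
  have hwΛ : 1 ≤ w * Λ := one_le_mul_of_one_le_of_one_le hw1 hΛ1
  have hqwΛ : 1 ≤ q * (w * Λ) := one_le_mul_of_one_le_of_one_le hq1 hwΛ
  have hqw : 1 ≤ q * w := one_le_mul_of_one_le_of_one_le hq1 hw1
  have hqx : 1 ≤ q * x := one_le_mul_of_one_le_of_one_le hq1 hx1
  have hsn : √n * √n = n := Real.mul_self_sqrt hn0.le
  have hsL : √L * √L = L := Real.mul_self_sqrt hL0.le
  have hsn0 : 0 < √n := Real.sqrt_pos.2 hn0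
  have hsL1 : 1 ≤ √L := Real.one_le_sqrt.2 hL1
  obtain ⟨m, hm⟩ : ∃ m : ℕ, m = ⌊8 * (q * (w * Λ))⌋₊ := ⟨_, rfl⟩
  have hmle : (m : ℝ) ≤ 8 * (q * (w * Λ)) := by
    rw [hm]
    exact Nat.floor_le (by linarith)
  have hmlt : 8 * (q * (w * Λ)) < m + 1 := by
    rw [hm]
    exact Nat.lt_floor_add_one _
  have hmge : 7 * (q * (w * Λ)) ≤ m := by linarith
  have hm0 : (0 : ℝ) < m := by linarith
  have hle : √n * √L ≤ q * (w * Λ) := by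
    rw [hsqrt]
    exact le_mul_of_one_le_left (by positivity) hq1
  -- If `n ≤ m`, one part suffices. Otherwise `n > m` forces `n ≥ 64 * L ≥ 64`, so `L ≥ 6`, which
  -- absorbs the constants below.
  rcases le_or_gt (Fintype.card V) m with hVm | hVm
  · have hpos : 0 < Fintype.card V := by
      have : (0 : ℝ) < Fintype.card V := hn ▸ hn0
      exact_mod_cast this
    obtain ⟨W, hW, H, hcont, hbag⟩ :=
      exists_isContained_strongProduct_of_card_le (G := G) hVm hpos
    refine ⟨W, hW, H, m, hcont, ?_, hmle⟩
    have h1 : (treewidth H : ℝ) ≤ 0 := by exact_mod_cast (treewidth_le hbag).trans (by simp)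
    exact h1.trans (mul_nonneg (by linarith) hL0.le)
  have hn64 : 64 * L ≤ n := by
    have h1 : (m : ℝ) + 1 ≤ n := by rw [hn]; exact_mod_cast hVm
    have h2 : √n * (8 * √L) ≤ √n * √n := by linarith
    have h3 : 8 * √L ≤ √n := le_of_mul_le_mul_left h2 hsn0
    calc 64 * L = (8 * √L) * (8 * √L) := by linarith
      _ ≤ √n * √n := by gcongr
      _ = n := hsn
  have hL6 : 6 ≤ L := by
    rw [hL, Real.le_logb_iff_rpow_le one_lt_two hn0]
    have : (2 : ℝ) ^ (6 : ℝ) = 64 := by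
      rw [show (6 : ℝ) = (6 : ℕ) by norm_num, Real.rpow_natCast]
      norm_num
    linarith
  have hsm : 2 * t * R + 1 ≤ m := by
    have h1 : (2 * t * R + 1 : ℝ) ≤ m := by
      refine le_trans ?_ hmge
      have h2 : (t : ℝ) * (2 * R) ≤ q * w * (7 * Λ - 1) := by
        gcongr
        linarith
      linarith
    exact_mod_cast h1
  obtain ⟨W, hW, H, hcont, hbag⟩ :=
    exists_isContained_strongProduct hε0 (hn ▸ hR) le_rfl hsm (ht _)
  rw [← hn] at hbag
  refine ⟨W, hW, H, m, hcont, ?_, hmle⟩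
  have hsplit : 2 * ε * n / m ≤ q * w / 7 := by
    rw [hεn, div_le_iff₀ hm0]
    calc w * w * Λ ≤ q * q * (w * w * Λ) :=
          le_mul_of_one_le_left (by positivity) (one_le_mul_of_one_le_of_one_le hq1 hq1)
      _ = q * w / 7 * (7 * (q * (w * Λ))) := by ring
      _ ≤ q * w / 7 * m := by gcongr
  have hlevels : Real.logb 2 (max 1 (2 * n / m)) ≤ L / 2 := by
    have h1 : max 1 (2 * n / m) ≤ √n := by
      refine max_le (Real.one_le_sqrt.2 (by linarith)) ?_
      rw [div_le_iff₀ hm0]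
      have h2 : √n ≤ √n * √L := le_mul_of_one_le_right hsn0.le hsL1
      calc 2 * n = √n * (2 * √n) := by linarith
        _ ≤ √n * m := by
          gcongr
          linarith
    refine (Real.logb_le_logb_of_le one_lt_two (by positivity) h1).trans_eq ?_
    rw [Real.sqrt_eq_rpow, Real.logb_rpow_eq_mul_logb_of_pos hn0, hL]
    ring
  -- The factor `8 / 7` collects `q * w` for the model and `q * w / 7` for the cut sets; `y ≤ √L`
  -- and `√L ≥ 16 / 7` finish.
  have hLy : 8 / 7 * y ≤ L / 2 := by
    have h2 : 16 / 7 ≤ √L := Real.le_sqrt_of_sq_le (by linarith)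
    nlinarith
  have h1 : (treewidth H : ℝ) ≤
      ⌊(t + 1 + 2 * ε * n / m + Real.logb 2 (max 1 (2 * n / m)) : ℝ)⌋₊ - 1 := by
    exact_mod_cast treewidth_le hbag
  have h2 := Nat.floor_le (a := (t + 1 + 2 * ε * n / m + Real.logb 2 (max 1 (2 * n / m)) : ℝ))
    (add_nonneg (by positivity) (Real.logb_nonneg one_lt_two (le_max_left _ _)))
  -- The `- 1` in the tree-width cancels the extra leaf part.
  calc (treewidth H : ℝ) ≤ q * w * (8 / 7) + L / 2 := by linarith
    _ = q * x * (8 / 7 * y) + 1 * (L / 2) := by rw [hwxy]; ring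
    _ ≤ q * x * (L / 2) + q * x * (L / 2) := by gcongr
    _ = q * x * L := by ring

lemma bounds_of_two_le {a c : ℝ} (ha : 0 < a) (hc : 1 ≤ c) {V : Type*} [Fintype V]
    (G : SimpleGraph V) (hn : 2 ≤ Fintype.card V)
    (hω : ∀ r : ℕ, (shallowCliqueNumber r G : ℝ) ≤ c * ((r : ℝ) + 1) ^ a)
    (hlog : (Real.logb 2 (Fintype.card V : ℝ)) ^ (2 * a + 1) ≤ (Fintype.card V : ℝ)) :
    (∃ (W : Type) (_ : Fintype W) (H : SimpleGraph W) (m : ℕ),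
      G.IsContained (strongProduct H (⊤ : SimpleGraph (Fin m))) ∧
      (treewidth H : ℝ) ≤ c * (8 : ℝ) ^ a * (Fintype.card V : ℝ) ^ (1 / 2 - 1 / (2 * a + 2)) *
        Real.logb 2 (Fintype.card V : ℝ) ∧
      (m : ℝ) ≤ c * (8 : ℝ) ^ (a + 1) *
        ((Fintype.card V : ℝ) * Real.logb 2 (Fintype.card V : ℝ)) ^ (1 / 2 : ℝ)) ∧
    (treewidth G : ℝ) ≤ (c ^ 2 * (8 : ℝ) ^ (2 * a + 1) + 1) *
      ((Fintype.card V : ℝ) * Real.logb 2 (Fintype.card V : ℝ)) ^ (1 - 1 / (2 * a + 2)) ∧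
    (separationNumber G : ℝ) ≤ (c ^ 2 * (8 : ℝ) ^ (2 * a + 1) + 1) *
      ((Fintype.card V : ℝ) * Real.logb 2 (Fintype.card V : ℝ)) ^ (1 - 1 / (2 * a + 2)) + 1 := by
  set n : ℝ := (Fintype.card V : ℝ) with hndef
  set L : ℝ := Real.logb 2 n with hLdef
  have hn2 : (2 : ℝ) ≤ n := by rw [hndef]; exact_mod_cast hn
  have hn0 : 0 < n := by linarith
  have hL1 : 1 ≤ L := by
    rw [hLdef, Real.le_logb_iff_rpow_le one_lt_two hn0]
    simpa using hn2
  have hL0 : 0 < L := by linarith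
  have hX0 : 0 < n * L := by positivity
  -- Chosen so that `Λ ^ (2 * a + 1) = n * L / Λ`, which equates the model cost with `2 * ε * n` for
  -- `ε = L / (2 * Λ)`.
  set Λ : ℝ := (n * L) ^ (1 / (2 * a + 2)) with hΛdef
  have hΛ0 : 0 < Λ := Real.rpow_pos_of_pos hX0 _
  have hΛpow : ∀ b : ℝ, Λ ^ b = (n * L) ^ (b / (2 * a + 2)) := fun b => by
    rw [hΛdef, ← Real.rpow_mul hX0.le]
    congr 1
    ring
  have ha2 : 2 * a + 2 ≠ 0 := by linarith
  have hΛfull : Λ ^ (2 * a + 2) = n * L := by rw [hΛpow, div_self ha2, Real.rpow_one]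
  have hΛlarge : Λ ^ (2 * a + 1) = (n * L) ^ (1 - 1 / (2 * a + 2)) := by
    rw [hΛpow]
    congr 1
    field_simp
    ring
  have hΛhalf : Λ ^ (a + 1) = (n * L) ^ (1 / 2 : ℝ) := by
    rw [hΛpow]
    congr 1
    field_simp
  have hΛa : Λ ^ a = n ^ (1 / 2 - 1 / (2 * a + 2)) * L ^ (1 / 2 - 1 / (2 * a + 2)) := by
    rw [← Real.mul_rpow hn0.le hL0.le, hΛpow]
    congr 1
    field_simp
    ring
  -- This is where the assumption `(log n)^(2a+1) ≤ n` enters; it ensures `ε ≤ 1`.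
  have hLΛ : L ≤ Λ := by
    have h1 : L ^ (2 * a + 2) ≤ n * L := by
      rw [show 2 * a + 2 = (2 * a + 1) + 1 by ring, Real.rpow_add hL0, Real.rpow_one]
      gcongr
    rw [← hΛfull] at h1
    exact (Real.rpow_le_rpow_iff hL0.le hΛ0.le (by linarith)).1 h1
  have hΛ1 : 1 ≤ Λ := hL1.trans hLΛ
  set q : ℝ := c * 8 ^ a with hq
  have hq1 : 1 ≤ q := one_le_mul_of_one_le_of_one_le hc (Real.one_le_rpow (by norm_num) ha.le)
  have hW1 : 1 ≤ Λ ^ a := Real.one_le_rpow hΛ1 ha.le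
  obtain ⟨R, t, hR, ht, hRΛ, htΛ⟩ := exists_parameters ha G hn hω hLdef hL1 hLΛ hc
  set ε : ℝ := L / (2 * Λ) with hε
  have hε0 : 0 ≤ ε := by positivity
  have hpow1 : Λ ^ (a + 1) = Λ ^ a * Λ := by rw [Real.rpow_add hΛ0, Real.rpow_one]
  have hpow2 : Λ ^ (2 * a + 1) = Λ ^ a * Λ ^ a * Λ := by
    rw [← Real.rpow_add hΛ0, ← Real.rpow_add_one hΛ0.ne']
    congr 1
    ring
  have hεn : 2 * ε * n = Λ ^ (2 * a + 1) := by
    have h : Λ ^ (2 * a + 1) * Λ = n * L := by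
      rw [← Real.rpow_add_one hΛ0.ne', ← hΛfull]
      congr 1
      ring
    rw [hε]
    field_simp
    linarith
  have htt : (t : ℝ) * (2 * t * R + 1) ≤ c ^ 2 * 8 ^ (2 * a + 1) * Λ ^ (2 * a + 1) := by
    have h8 : c ^ 2 * (8 : ℝ) ^ (2 * a + 1) = 8 * q ^ 2 := by
      rw [hq, mul_pow, ← Real.rpow_natCast (8 ^ a), ← Real.rpow_mul (by norm_num),
        Real.rpow_add (by norm_num), Real.rpow_one, mul_comm a]
      push_cast
      ring
    have h1 : (t : ℝ) ≤ t * t := by exact_mod_cast Nat.le_mul_self t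
    have h2 : (t : ℝ) * t ≤ (q * Λ ^ a) * (q * Λ ^ a) := by gcongr
    calc (t : ℝ) * (2 * t * R + 1) ≤ t * t * (2 * R + 1) := by linarith
      _ ≤ (q * Λ ^ a) * (q * Λ ^ a) * (8 * Λ) := by
        gcongr
        linarith
      _ = _ := by rw [h8, hpow2]; ring
  have hts : (t : ℝ) * (2 * t * R + 1 : ℕ) + 2 * ε * n ≤
      (c ^ 2 * (8 : ℝ) ^ (2 * a + 1) + 1) * (n * L) ^ (1 - 1 / (2 * a + 2)) := by
    rw [hεn, ← hΛlarge, add_mul, one_mul]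
    push_cast
    gcongr
  refine ⟨?_, ?_, ?_⟩
  · have hA0 : 0 ≤ 1 / 2 - 1 / (2 * a + 2) :=
      sub_nonneg.2 (one_div_le_one_div_of_le two_pos (by linarith))
    have hA2 : 1 / 2 - 1 / (2 * a + 2) ≤ 1 / 2 := sub_le_self _ (by positivity)
    have hy : L ^ (1 / 2 - 1 / (2 * a + 2)) ≤ √L := by
      rw [Real.sqrt_eq_rpow]
      exact Real.rpow_le_rpow_of_exponent_le hL1 hA2
    have hsqrt : Λ ^ a * Λ = √n * √L := by
      rw [← hpow1, hΛhalf, ← Real.sqrt_eq_rpow, Real.sqrt_mul hn0.le]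
    obtain ⟨W, hW, H, m, hcont, htw, hm⟩ := exists_strongProduct_of_parameters hndef hn2 hLdef hL1
      hΛ1 hq1 hW1 (Real.one_le_rpow (by linarith) hA0) hy hΛa hsqrt hε0 (hεn.trans hpow2) hR ht hRΛ
      htΛ
    refine ⟨W, hW, H, m, hcont, htw, hm.trans_eq ?_⟩
    rw [← hΛhalf, Real.rpow_add_one (by norm_num), hpow1, hq]
    ring
  · have h1 : (treewidth G : ℝ) ≤ ⌊(t * (2 * t * R + 1 : ℕ) + 2 * ε * n : ℝ)⌋₊ - 1 := by
      exact_mod_cast treewidth_le (hasBagSizeAtMost_floor hε0 hR le_rfl (ht _))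
    have h2 := Nat.floor_le (a := (t * (2 * t * R + 1 : ℕ) + 2 * ε * n : ℝ)) (by positivity)
    linarith
  · have h1 := separationNumber_le hε0 hR le_rfl (ht _) (by omega)
    have h2 : 0 ≤ ε * n := by positivity
    linarith

end Numerics
end ProductStructure

/-! ### The theorem -/

open ProductStructure

theorem mainTheorem7 (a c : ℝ) (ha : 0 < a) (hc : 0 < c)
    {V : Type*} [Fintype V] (G : SimpleGraph V) (n : ℕ) (hcard : Fintype.card V = n)
    (hn : 1 ≤ n)
    (hω : ∀ r : ℕ, (ProductStructure.shallowCliqueNumber r G : ℝ) ≤ c * ((r : ℝ) + 1) ^ a)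
    (hlog : (Real.logb 2 (n : ℝ)) ^ (2 * a + 1) ≤ (n : ℝ)) :
    (2 ≤ n →
      ∃ Y : Finset V,
        (Y.card : ℝ) ≤ ((n : ℝ) * Real.logb 2 (n : ℝ)) ^ (1 - 1 / (2 * a + 2)) ∧
        ∃ (W : Type) (_ : Fintype W) (H : SimpleGraph W) (m : ℕ),
          (G.induce ((Y : Set V)ᶜ)).IsContained
            (ProductStructure.strongProduct H (⊤ : SimpleGraph (Fin m))) ∧
          (ProductStructure.treewidth H : ℝ) ≤
            c * (8 : ℝ) ^ a * (n : ℝ) ^ (1 / 2 - 1 / (2 * a + 2)) * Real.logb 2 (n : ℝ) ∧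
          (m : ℝ) ≤
            c * (8 : ℝ) ^ (a + 1) * ((n : ℝ) * Real.logb 2 (n : ℝ)) ^ (1 / 2 : ℝ)) ∧
    (ProductStructure.treewidth G : ℝ) ≤
      (c ^ 2 * (8 : ℝ) ^ (2 * a + 1) + 1) *
        ((n : ℝ) * Real.logb 2 (n : ℝ)) ^ (1 - 1 / (2 * a + 2)) ∧
    (ProductStructure.separationNumber G : ℝ) ≤
      (c ^ 2 * (8 : ℝ) ^ (2 * a + 1) + 1) *
        ((n : ℝ) * Real.logb 2 (n : ℝ)) ^ (1 - 1 / (2 * a + 2)) + 1 := by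
  subst hcard
  -- A single vertex is a `0`-shallow `K_1`, so the hypothesis at `r = 0` reads `1 ≤ c`.
  have hc1 : 1 ≤ c := by
    obtain ⟨v⟩ : Nonempty V := Fintype.card_pos_iff.1 hn
    have h1 : IsCliqueModel G 0 1 {{v}} :=
      ⟨by simpa using isShallowSet_singleton 0 v, by simp, by simp, by simp⟩
    have h2 : (1 : ℝ) ≤ shallowCliqueNumber 0 G := by
      simpa using h1.card_le_shallowCliqueNumber
    simpa using h2.trans (hω 0)
  rcases hn.eq_or_lt with hn1 | hn2
  · have h0 : Fintype.card V = 1 := hn1.symm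
    have hexp : 1 - 1 / (2 * a + 2) ≠ 0 := by
      have : 1 / (2 * a + 2) < 1 := by rw [div_lt_one (by linarith)]; linarith
      linarith
    -- For `n = 1` the logarithm vanishes, so the claims are tree-width at most 0 and
    -- separation-number at most 1; the recursion with `ε = 0`, `R = 0` and `s = t = 1` gives both.
    have hzero : ((Fintype.card V : ℝ) * Real.logb 2 (Fintype.card V : ℝ)) ^
        (1 - 1 / (2 * a + 2)) = 0 := by
      rw [h0, Nat.cast_one, Real.logb_one, mul_zero, Real.zero_rpow hexp]
    rw [hzero, mul_zero, zero_add]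
    have hs : 2 * 1 * 0 + 1 ≤ 1 := le_rfl
    have ht : ∀ S, IsCliqueModel G (2 * 0) 1 S → S.card ≤ 1 := fun S hS => by
      refine Finset.card_le_one.2 fun P hP Q hQ => ?_
      have : Subsingleton V := Fintype.card_le_one_iff_subsingleton.1 h0.le
      obtain ⟨u, hu⟩ := (hS.shallow P hP).nonempty
      obtain ⟨v, hv⟩ := (hS.shallow Q hQ).nonempty
      by_contra hne
      exact Finset.disjoint_left.1 (hS.disj P hP Q hQ hne) hu (Subsingleton.elim u v ▸ hv)
    have hR : (Fintype.card V : ℝ) ≤ (1 + 0) ^ 0 := by simp [h0]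
    refine ⟨fun h => absurd h (by omega), ?_, ?_⟩
    · have h := treewidth_le (hasBagSizeAtMost_floor le_rfl hR hs ht)
      have h' : treewidth G ≤ 0 := by simpa using h
      exact_mod_cast h'
    · simpa using separationNumber_le le_rfl hR hs ht (by omega)
  · obtain ⟨h1, h2, h3⟩ := bounds_of_two_le ha hc1 G hn2 hω hlog
    refine ⟨fun _ => ⟨∅, ?_, ?_⟩, h2, h3⟩
    · rw [Finset.card_empty, Nat.cast_zero]
      exact Real.rpow_nonneg (mul_nonneg (Nat.cast_nonneg _)
        (Real.logb_nonneg one_lt_two (by exact_mod_cast hn))) _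
    · obtain ⟨W, hW, H, m, hcont, htw, hm⟩ := h1
      exact ⟨W, hW, H, m, SimpleGraph.IsContained.trans ⟨(SimpleGraph.Embedding.induce _).toCopy⟩ hcont, htw, hm⟩
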